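/- Let $a,b>0$. For $\beta>0$ put $G_\beta(x,y)=\left(y,-x+\frac{y}{\beta+y^2}\right)$, let $G_{b,a}=G_b\circ G_a:\mathbb R^2\to\mathbb R^2$, and let $V_{b,a}(x,y)=ax^2+by^2-xy+x^2y^2$. When $ab<1/4$ let $$P_\pm=\left(\pm\sqrt{-b+\tfrac12\sqrt{b/a}},\ \pm\sqrt{-a+\tfrac12\sqrt{a/b}}\right),\qquad h_{\min}=-\tfrac14-ab+\sqrt{ab}.$$ Terminology. A set $S$ is invariant if $G_{b,a}(S)=S$. A closed curve $C$ surrounds a set $S$ if $S\cap C=\emptyset$ and every point of $S$ lies in a bounded component of $\mathbb R^2\setminus C$. "Diffeomorphic to a circle (a line)" means: image of a $C^\infty$ embedding of $\mathbb R/\mathbb Z$ (of $\mathbb R$) in $\mathbb R^2$. "Conjugate to a rotation (translation)" means: conjugate, by such a $C^\infty$ embedding onto the curve, to $t\mapsto t+\theta$ on $\mathbb R/\mathbb Z$ (to $t\mapsto t+\tau$ with $\tau\neq0$ on $\mathbb R$). A fixed point $p$ is a hyperbolic saddle if the derivative at $p$ has real eigenvalues $\mu,\nu$ with $|\mu|<1<|\nu|$.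 It is of elliptic type if all eigenvalues of the derivative at $p$ have modulus one and $p$ is a center: for every neighbourhood $U$ of $p$, all points other than $p$ of some neighbourhood of $p$ lie on invariant curves contained in $U$, diffeomorphic to circles and surrounding $p$. It is linearly elliptic if the eigenvalues of the derivative at $p$ are nonreal and of modulus one. The stable (unstable) manifold of $p$ is the set of points whose forward orbit converges to $p$ (which have a backward orbit converging to $p$). (a) If $ab\ge 1/4$, the origin is the unique fixed point of $G_{b,a}$ and it is of elliptic type; it is linearly elliptic if $ab>1/4$. For every $h>0$ the set $\{V_{b,a}=h\}$ surrounds the origin, is diffeomorphic to a circle and is invariant under $G_{b,a}$, and on it $G_{b,a}$ is conjugate to a rotation. (b) If $ab<1/4$, then: (i) The origin is a hyperbolic saddle of $G_{b,a}$. The set $\{V_{b,a}=0\}\setminus\{(0,0)\}$ coincides with the stable manifold of the origin, and with its unstable manifold, the origin itself being removed from both. It is the disjoint union of two curves diffeomorphic to the real line, each of which forms a compact loop when the origin is added. Each of the two curves is invariant under $G_{b,a}$, and on each of them $G_{b,a}$ is conjugate to a translation. (ii) For every $h>0$ the set $\{V_{b,a}=h\}$ is diffeomorphic to a circle, surrounds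 the set $\{V_{b,a}\le 0\}$ and is invariant under $G_{b,a}$, and on it $G_{b,a}$ is conjugate to a rotation. (iii) The fixed points of $G_{b,a}$ are exactly $(0,0)$, $P_+$ and $P_-$. The points $P_\pm$ are different from the origin, $V_{b,a}(P_\pm)=h_{\min}$, and they are of elliptic type. They are linearly elliptic if $ab\ne 1/16$, while for $ab=1/16$ the derivative of $G_{b,a}$ at $P_\pm$ is $-\mathrm{Id}$. (iv) If $h<h_{\min}$, the set $\{V_{b,a}=h\}$ is empty. If $h_{\min}<h<0$, it is the disjoint union of two curves diffeomorphic to circles, one of which surrounds $P_+$ but not $P_-$, and the other $P_-$ but not $P_+$. Each of them is invariant under $G_{b,a}$, and on each of them $G_{b,a}$ is conjugate to a rotation. -/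

import Mathlib

open Set Filter Topology
open scoped ContDiff

noncomputable section

namespace PlanarDynamics

/-! ### Curves in the plane -/

/-- `γ` is a smooth regular parametrization of `C` by the circle `ℝ / ℤ`: the induced map
`ℝ / ℤ → ℝ²` is an injective immersion (hence, by compactness, a smooth embedding) with image `C`. -/
structure IsCircleParam (γ : ℝ → ℝ × ℝ) (C : Set (ℝ × ℝ)) : Prop where
  smooth : ContDiff ℝ ∞ γ
  regular : ∀ t, deriv γ t ≠ 0
  eq_iff : ∀ s t, γ s = γ t ↔ ∃ n : ℤ, t = s + n
  range_eq : range γ = C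

/-- `γ` is a smooth embedding of the real line in the plane with image `L`. -/
structure IsLineParam (γ : ℝ → ℝ × ℝ) (L : Set (ℝ × ℝ)) : Prop where
  smooth : ContDiff ℝ ∞ γ
  regular : ∀ t, deriv γ t ≠ 0
  embedding : IsEmbedding γ
  range_eq : range γ = L

/-- `C` is diffeomorphic to a circle. -/
def DiffeoCircle (C : Set (ℝ × ℝ)) : Prop := ∃ γ, IsCircleParam γ C

/-- `L` is diffeomorphic to the real line. -/
def DiffeoLine (L : Set (ℝ × ℝ)) : Prop := ∃ γ, IsLineParam γ L

/-- `C` surrounds `S`: every point of `S` lies off `C`, in a bounded component of the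
complement of `C`. -/
def Surrounds (C S : Set (ℝ × ℝ)) : Prop :=
  ∀ p ∈ S, p ∉ C ∧ Bornology.IsBounded (connectedComponentIn Cᶜ p)

/-! ### Maps on curves -/

/-- `S` is invariant under the map `G`. -/
def Invariant (G : ℝ × ℝ → ℝ × ℝ) (S : Set (ℝ × ℝ)) : Prop := G '' S = S

/-- On `C`, the map `G` is conjugate to a rotation of the circle `ℝ / ℤ`, by a diffeomorphism. -/
def ConjRotationOn (G : ℝ × ℝ → ℝ × ℝ) (C : Set (ℝ × ℝ)) : Prop :=
  ∃ γ, IsCircleParam γ C ∧ ∃ θ : ℝ, ∀ t, G (γ t) = γ (t + θ)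

/-- On `L`, the map `G` is conjugate to a nontrivial translation of the real line,
by a diffeomorphism. -/
def ConjTranslationOn (G : ℝ × ℝ → ℝ × ℝ) (L : Set (ℝ × ℝ)) : Prop :=
  ∃ γ, IsLineParam γ L ∧ ∃ τ : ℝ, τ ≠ 0 ∧ ∀ t, G (γ t) = γ (t + τ)

/-! ### Fixed points -/

/-- The complex eigenvalues of the derivative of `G` at `p`, with multiplicity. -/
def multipliers (G : ℝ × ℝ → ℝ × ℝ) (p : ℝ × ℝ) : Multiset ℂ :=
  ((fderiv ℝ G p : (ℝ × ℝ) →ₗ[ℝ] (ℝ × ℝ)).charpoly).aroots ℂ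

/-- Hyperbolic saddle: a fixed point at which the derivative has one real eigenvalue inside and
one outside the unit circle. -/
structure IsHyperbolicSaddle (G : ℝ × ℝ → ℝ × ℝ) (p : ℝ × ℝ) : Prop where
  fixed : G p = p
  diff : DifferentiableAt ℝ G p
  eigen : ∃ μ ν : ℝ, |μ| < 1 ∧ 1 < |ν| ∧ multipliers G p = {(μ : ℂ), (ν : ℂ)}

/-- Elliptic fixed point in the strict, linear sense: the eigenvalues of the derivative are
nonreal of modulus one. -/
structure IsElliptic (G : ℝ × ℝ → ℝ × ℝ) (p : ℝ × ℝ) : Prop where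
  fixed : G p = p
  diff : DifferentiableAt ℝ G p
  eigen : ∀ z ∈ multipliers G p, ‖z‖ = 1 ∧ z.im ≠ 0

/-- Fixed point of elliptic type: the eigenvalues of the derivative lie on the unit circle and the
point is a center, that is, all nearby points lie on small invariant closed curves
surrounding it. -/
structure IsEllipticType (G : ℝ × ℝ → ℝ × ℝ) (p : ℝ × ℝ) : Prop where
  fixed : G p = p
  diff : DifferentiableAt ℝ G p
  eigen : ∀ z ∈ multipliers G p, ‖z‖ = 1
  center : ∀ U ∈ 𝓝 p, ∃ W ∈ 𝓝 p, ∀ q ∈ W, q ≠ p →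
    ∃ C ⊆ U, q ∈ C ∧ DiffeoCircle C ∧ Invariant G C ∧ Surrounds C {p}

/-- The (global) stable manifold of `p`. -/
def stableSet (G : ℝ × ℝ → ℝ × ℝ) (p : ℝ × ℝ) : Set (ℝ × ℝ) :=
  {q | Tendsto (fun n : ℕ => G^[n] q) atTop (𝓝 p)}

/-- The (global) unstable manifold of `p`: the points with a backward orbit tending to `p`. -/
def unstableSet (G : ℝ × ℝ → ℝ × ℝ) (p : ℝ × ℝ) : Set (ℝ × ℝ) :=
  {q | ∃ u : ℕ → ℝ × ℝ, u 0 = q ∧ (∀ n, G (u (n + 1)) = u n) ∧ Tendsto u atTop (𝓝 p)}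

/-! ### The maps -/

/-- `G_β (x, y) = (y, -x + y / (β + y²))`. -/
def Gone (β : ℝ) (p : ℝ × ℝ) : ℝ × ℝ := (p.2, -p.1 + p.2 / (β + p.2 ^ 2))

/-- The composition map `G_{b,a} = G_b ∘ G_a`. -/
def Gcomp (b a : ℝ) : ℝ × ℝ → ℝ × ℝ := Gone b ∘ Gone a

/-- `V_{b,a} (x, y) = a x² + b y² - x y + x² y²`. -/
def V (b a : ℝ) (p : ℝ × ℝ) : ℝ :=
  a * p.1 ^ 2 + b * p.2 ^ 2 - p.1 * p.2 + p.1 ^ 2 * p.2 ^ 2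

/-- The level set `{V_{b,a} = h}`. -/
def level (b a h : ℝ) : Set (ℝ × ℝ) := {p | V b a p = h}

/-- The point `P₊`; the radicands are positive when `a, b > 0` and `a b < 1/4`. -/
def Pplus (b a : ℝ) : ℝ × ℝ :=
  (√(-b + 1 / 2 * √(b / a)), √(-a + 1 / 2 * √(a / b)))

/-- The point `P₋ = -P₊`. -/
def Pminus (b a : ℝ) : ℝ × ℝ :=
  (-√(-b + 1 / 2 * √(b / a)), -√(-a + 1 / 2 * √(a / b)))

/-- `h_min = -1/4 - a b + √(a b)`. -/
def hmin (b a : ℝ) : ℝ := -(1 / 4) - a * b + √(a * b)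

end PlanarDynamics

end

open PlanarDynamics

/-!
`G_β` swaps the two roots `x` of the quadratic equation `V_{b,a}(x, y) = h`, so `V = V_{b,a}` is
an integral of `G_{b,a}` (`V_Gcomp`), and being area-preserving the map carries trajectories of the
Hamiltonian field of `V` to trajectories (`hasDerivAt_Gcomp_comp`). Suppose a closed level curve
carries no critical point of `V`. Parametrized by the rescaled time of the Hamiltonian flow, it
becomes a periodic solution of a differential equation that the map preserves; by uniqueness of
solutions the map is then a shift of time, that is a rotation (`conjRotationOn_of_diffeoCircle`).
No existence theorem is needed, since the time is obtained by a quadrature from any smooth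
parametrization of the curve.

It remains to see that the levels are closed curves. With `c = √(ab)`, everything can be made
explicit.
* For `h > 0` the level is star-shaped about the origin, the squared radius being the positive root
  of a quadratic equation (`diffeoCircle_level`).
* For `h = -m² < 0` the level lies in `xy > 0`. In the coordinates `f = log (xy / m) / 2` and
  `g = log (√a x / (√b y)) / 2` it reads `m cosh 2f + c cosh 2g = 1/2`, and `sinh f`, `sinh g`
  rescale it to the unit circle (`V_exp_eq_iff`, `diffeoCircle_rightLevel`).
* For `h = 0` and `c < 1/2` the two loops are the orbits of a pair of hyperbolic secants, on which
  the map is visibly a shift by the addition theorem (`Gcomp_soliton`, `isLineParam_soliton`).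
  Iterates tend to the origin in both time directions, while a point whose orbit tends to the
  origin has `V = 0` by continuity.

Fixed points are critical points of `V`, and `V - h_min` is a sum of two squares vanishing exactly
at `P±` (`V_sub_hmin`), so that the levels near `P±` give the centers. At a fixed point the
derivative has determinant one, and its trace is `1/(ab) - 2` at the origin (`trace_zero`) and
`4 (4c - 1)² - 2` at `P±` (`trace_critical`). All statements about the left half-plane follow from
those about the right one by the reflection `p ↦ -p`.
-/

namespace PlanarDynamics

/-! ### The integral `V` and its Hamiltonian vector field -/

/-- The Hamiltonian vector field `(∂V/∂y, -∂V/∂x)` of `V b a`. -/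
def hamField (b a : ℝ) (p : ℝ × ℝ) : ℝ × ℝ :=
  (2 * b * p.2 - p.1 + 2 * p.1 ^ 2 * p.2, -(2 * a * p.1 - p.2 + 2 * p.1 * p.2 ^ 2))

variable {a b : ℝ}

/-- `G_a` exchanges the two roots `x` of the quadratic equation `V = h`, up to swapping the
coordinates. -/
lemma V_Gone (ha : 0 < a) (b : ℝ) (p : ℝ × ℝ) : V a b (Gone a p) = V b a p := by
  have : a + p.2 ^ 2 ≠ 0 := by positivity
  simp only [V, Gone]
  field_simp
  ring

lemma V_Gcomp (ha : 0 < a) (hb : 0 < b) (p : ℝ × ℝ) : V b a (Gcomp b a p) = V b a p := by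
  rw [Gcomp, Function.comp_apply, V_Gone hb, V_Gone ha]

lemma V_iterate (ha : 0 < a) (hb : 0 < b) (n : ℕ) (p : ℝ × ℝ) :
    V b a ((Gcomp b a)^[n] p) = V b a p := by
  induction n with
  | zero => rfl
  | succ n ih => rw [Function.iterate_succ_apply', V_Gcomp ha hb, ih]

lemma V_neg (b a : ℝ) (p : ℝ × ℝ) : V b a (-p) = V b a p := by
  simp [V]

lemma Gcomp_neg (b a : ℝ) (p : ℝ × ℝ) : Gcomp b a (-p) = -Gcomp b a p := by
  ext
  · simp [Gcomp, Gone]; ring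
  · simp only [Gcomp, Gone, Function.comp_apply, Prod.fst_neg, Prod.snd_neg]
    rw [show - -p.1 + -p.2 / (a + (-p.2) ^ 2) = -(-p.1 + p.2 / (a + p.2 ^ 2)) by ring]
    ring

lemma Gcomp_zero (b a : ℝ) : Gcomp b a (0, 0) = (0, 0) := by simp [Gcomp, Gone]

lemma continuous_V (b a : ℝ) : Continuous (V b a) := by
  unfold V; fun_prop

lemma contDiff_hamField (b a : ℝ) : ContDiff ℝ ∞ (hamField b a) := by
  unfold hamField; fun_prop

/-- `G_a` carries the trajectories of the Hamiltonian field of `V b a` to those of `V a b`. -/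
lemma hasDerivAt_Gone_comp (ha : 0 < a) {γ : ℝ → ℝ × ℝ} {T t : ℝ}
    (h : HasDerivAt γ (T • hamField b a (γ t)) t) :
    HasDerivAt (fun t => Gone a (γ t)) (T • hamField a b (Gone a (γ t))) t := by
  have h0 : a + (γ t).2 ^ 2 ≠ 0 := by positivity
  have h1 : HasDerivAt (fun t => (γ t).1) _ t := h.fst
  have h2 : HasDerivAt (fun t => (γ t).2) _ t := h.snd
  refine (h2.prodMk (h1.neg.add (h2.div ((h2.pow 2).const_add a) h0))).congr_deriv ?_
  ext
  · simp only [hamField, Gone, Prod.smul_fst, Prod.smul_snd, smul_eq_mul]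
    field_simp
    ring
  · simp only [hamField, Gone, Prod.smul_fst, Prod.smul_snd, smul_eq_mul]
    simp
    field_simp
    ring

lemma hasDerivAt_Gcomp_comp (ha : 0 < a) (hb : 0 < b) {γ : ℝ → ℝ × ℝ} {T t : ℝ}
    (h : HasDerivAt γ (T • hamField b a (γ t)) t) :
    HasDerivAt (fun t => Gcomp b a (γ t)) (T • hamField b a (Gcomp b a (γ t))) t :=
  hasDerivAt_Gone_comp hb (hasDerivAt_Gone_comp ha h)

/-- Levels are bounded: `V` differs from the definite form `ax² + by²` by `(xy - 1/2)² - 1/4`. -/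
lemma quad_le_V (b a : ℝ) (p : ℝ × ℝ) : a * p.1 ^ 2 + b * p.2 ^ 2 ≤ V b a p + 1 / 4 := by
  simp only [V]; nlinarith [sq_nonneg (p.1 * p.2 - 1 / 2)]

lemma isBounded_sublevel (ha : 0 < a) (hb : 0 < b) (h : ℝ) :
    Bornology.IsBounded {p | V b a p ≤ h} := by
  refine (Metric.isBounded_closedBall (x := (0 : ℝ × ℝ))
    (r := √((h + 1 / 4) / a) + √((h + 1 / 4) / b))).subset fun p hp => ?_
  have hp : V b a p ≤ h := hp
  have hq := quad_le_V b a p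
  rw [mem_closedBall_zero_iff, Prod.norm_def, max_le_iff, Real.norm_eq_abs, Real.norm_eq_abs]
  constructor
  · refine (Real.abs_le_sqrt ?_).trans (le_add_of_nonneg_right (Real.sqrt_nonneg _))
    rw [le_div_iff₀ ha]; nlinarith [sq_nonneg p.2]
  · refine (Real.abs_le_sqrt ?_).trans (le_add_of_nonneg_left (Real.sqrt_nonneg _))
    rw [le_div_iff₀ hb]; nlinarith [sq_nonneg p.1]

lemma isCompact_sublevel (ha : 0 < a) (hb : 0 < b) (h : ℝ) : IsCompact {p | V b a p ≤ h} :=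
  Metric.isCompact_of_isClosed_isBounded (isClosed_le (continuous_V b a) continuous_const)
    (isBounded_sublevel ha hb h)

/-- In the right half-plane, `V ≤ 0` forces the second coordinate to be positive. -/
lemma snd_pos_of_V_nonpos (ha : 0 < a) (hb : 0 < b) {p : ℝ × ℝ} (hV : V b a p ≤ 0)
    (h1 : 0 < p.1) : 0 < p.2 := by
  by_contra! h
  have := mul_nonneg h1.le (neg_nonneg.2 h)
  have : 0 < a * p.1 ^ 2 := by positivity
  have : 0 ≤ b * p.2 ^ 2 := by positivity
  have : 0 ≤ p.1 ^ 2 * p.2 ^ 2 := by positivity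
  simp only [V] at hV
  linarith

lemma eq_zero_of_fst_eq_zero (hb : 0 < b) {p : ℝ × ℝ} (hV : V b a p ≤ 0)
    (h1 : p.1 = 0) : p = (0, 0) := by
  simp only [V, h1] at hV
  have : p.2 ^ 2 ≤ 0 := by nlinarith
  have : p.2 = 0 := by nlinarith
  ext <;> simp [*]

/-- The part of the region `V ≤ 0` in the right half-plane is mapped to itself. -/
lemma Gcomp_fst_pos (ha : 0 < a) (hb : 0 < b) {p : ℝ × ℝ} (hV : V b a p ≤ 0)
    (h1 : 0 < p.1) : 0 < (Gcomp b a p).1 :=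
  snd_pos_of_V_nonpos hb ha (by rwa [V_Gone ha]) (snd_pos_of_V_nonpos (p := p) ha hb hV h1)

/-- The right half of the level set `V = h`. -/
def rightLevel (b a h : ℝ) : Set (ℝ × ℝ) := {p | V b a p = h ∧ 0 < p.1}

lemma mapsTo_rightLevel (ha : 0 < a) (hb : 0 < b) {h : ℝ} (h0 : h ≤ 0) :
    MapsTo (Gcomp b a) (rightLevel b a h) (rightLevel b a h) := fun p hp =>
  ⟨(V_Gcomp ha hb p).trans hp.1, Gcomp_fst_pos ha hb (hp.1.trans_le h0) hp.2⟩

lemma neg_rightLevel (b a h : ℝ) : -rightLevel b a h = {p | V b a p = h ∧ p.1 < 0} := by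
  ext p; simp [rightLevel, V_neg]

lemma disjoint_rightLevel_neg (b a h : ℝ) : Disjoint (rightLevel b a h) (-rightLevel b a h) := by
  rw [neg_rightLevel]
  exact Set.disjoint_left.2 fun p hp hq => lt_asymm hp.2 hq.2

lemma rightLevel_union_neg (hb : 0 < b) {h : ℝ} (h0 : h ≤ 0) :
    rightLevel b a h ∪ -rightLevel b a h = level b a h \ {((0, 0) : ℝ × ℝ)} := by
  rw [neg_rightLevel]
  ext p
  simp only [rightLevel, level, mem_union, mem_ofPred_eq, Set.mem_sdiff, mem_singleton_iff]
  constructor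
  · rintro (⟨h1, h2⟩ | ⟨h1, h2⟩) <;> exact ⟨h1, fun h => by simp [h] at h2⟩
  · rintro ⟨h1, h2⟩
    rcases lt_trichotomy p.1 0 with h3 | h3 | h3
    · exact Or.inr ⟨h1, h3⟩
    · exact absurd (eq_zero_of_fst_eq_zero hb (h1.trans_le h0) h3) h2
    · exact Or.inl ⟨h1, h3⟩

/-! ### Critical points of `V` and its minimum -/

/-- `V - h_min` as a sum of two squares. -/
lemma V_sub_hmin (ha : 0 < a) (hb : 0 < b) (p : ℝ × ℝ) :
    V b a p - hmin b a = (√a * p.1 - √b * p.2) ^ 2 + (p.1 * p.2 - (1 / 2 - √a * √b)) ^ 2 := by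
  have h1 := Real.sq_sqrt ha.le
  have h2 := Real.sq_sqrt hb.le
  rw [V, hmin, Real.sqrt_mul ha.le]
  linear_combination (-p.1 ^ 2 - √b ^ 2) * h1 + (-p.2 ^ 2 - a) * h2

lemma hmin_le_V (ha : 0 < a) (hb : 0 < b) (p : ℝ × ℝ) : hmin b a ≤ V b a p := by
  have := V_sub_hmin ha hb p
  nlinarith [sq_nonneg (√a * p.1 - √b * p.2), sq_nonneg (p.1 * p.2 - (1 / 2 - √a * √b))]

lemma sqrt_mul_sqrt_lt (ha : 0 < a) (hab : a * b < 1 / 4) : √a * √b < 1 / 2 := by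
  rw [← Real.sqrt_mul ha.le, Real.sqrt_lt' (by norm_num)]; linarith

/-- The coordinates of `P₊` are positive, and their ratio and product are explicit. -/
lemma Pplus_spec (ha : 0 < a) (hb : 0 < b) (hab : a * b < 1 / 4) :
    0 < (Pplus b a).1 ∧ 0 < (Pplus b a).2 ∧ √a * (Pplus b a).1 = √b * (Pplus b a).2 ∧
      (Pplus b a).1 * (Pplus b a).2 = 1 / 2 - √a * √b := by
  have hα := Real.sqrt_pos.2 ha
  have hβ := Real.sqrt_pos.2 hb
  have h1 := Real.sq_sqrt ha.le
  have h2 := Real.sq_sqrt hb.le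
  have hc := sqrt_mul_sqrt_lt ha hab
  set α := √a
  set β := √b
  have e1 : -b + 1 / 2 * √(b / a) = β / α * (1 / 2 - α * β) := by
    rw [Real.sqrt_div hb.le, ← h2]
    change -β ^ 2 + 1 / 2 * (√(β ^ 2) / α) = _
    rw [Real.sqrt_sq hβ.le]; field_simp; ring
  have e2 : -a + 1 / 2 * √(a / b) = α / β * (1 / 2 - α * β) := by
    rw [Real.sqrt_div ha.le, ← h1]
    change -α ^ 2 + 1 / 2 * (√(α ^ 2) / β) = _
    rw [Real.sqrt_sq hα.le]; field_simp; ring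
  have hd : 0 < 1 / 2 - α * β := by linarith
  have p1 : 0 < β / α * (1 / 2 - α * β) := by positivity
  have p2 : 0 < α / β * (1 / 2 - α * β) := by positivity
  simp only [Pplus, e1, e2]
  refine ⟨Real.sqrt_pos.2 p1, Real.sqrt_pos.2 p2, ?_, ?_⟩
  · rw [← sq_eq_sq₀ (by positivity) (by positivity), mul_pow, mul_pow, Real.sq_sqrt p1.le,
      Real.sq_sqrt p2.le]
    field_simp
  · rw [← Real.sqrt_mul p1.le, show β / α * (1 / 2 - α * β) * (α / β * (1 / 2 - α * β)) =
      (1 / 2 - α * β) ^ 2 by field_simp, Real.sqrt_sq hd.le]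

lemma Pminus_eq (b a : ℝ) : Pminus b a = -Pplus b a := rfl

lemma V_Pplus (ha : 0 < a) (hb : 0 < b) (hab : a * b < 1 / 4) :
    V b a (Pplus b a) = hmin b a := by
  obtain ⟨-, -, h3, h4⟩ := Pplus_spec ha hb hab
  have := V_sub_hmin ha hb (Pplus b a)
  rw [h3, h4] at this
  linarith

/-- A point of the open right half-plane is `P₊` as soon as it has the same ratio and product
of coordinates. -/
lemma eq_Pplus (ha : 0 < a) (hb : 0 < b) (hab : a * b < 1 / 4) {p : ℝ × ℝ} (h1 : 0 < p.1)
    (h2 : √a * p.1 = √b * p.2) (h3 : p.1 * p.2 = 1 / 2 - √a * √b) : p = Pplus b a := by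
  obtain ⟨k1, -, k3, k4⟩ := Pplus_spec ha hb hab
  have hα := Real.sqrt_pos.2 ha
  have hβ := Real.sqrt_pos.2 hb
  have e1 : p.1 = (Pplus b a).1 := by
    rw [← sq_eq_sq₀ h1.le k1.le]
    apply mul_left_cancel₀ hα.ne'
    linear_combination p.1 * h2 - (Pplus b a).1 * k3 + √b * h3 - √b * k4
  refine Prod.ext e1 (mul_left_cancel₀ hβ.ne' ?_)
  rw [← h2, ← k3, e1]

lemma eq_Pplus_of_V_eq (ha : 0 < a) (hb : 0 < b) (hab : a * b < 1 / 4) {p : ℝ × ℝ}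
    (h1 : 0 < p.1) (hV : V b a p = hmin b a) : p = Pplus b a := by
  have h := V_sub_hmin ha hb p
  rw [hV, sub_self] at h
  have e1 : √a * p.1 - √b * p.2 = 0 := by
    nlinarith [sq_nonneg (√a * p.1 - √b * p.2), sq_nonneg (p.1 * p.2 - (1 / 2 - √a * √b))]
  have e2 : p.1 * p.2 - (1 / 2 - √a * √b) = 0 := by
    nlinarith [sq_nonneg (√a * p.1 - √b * p.2), sq_nonneg (p.1 * p.2 - (1 / 2 - √a * √b))]
  exact eq_Pplus ha hb hab h1 (by linarith) (by linarith)

lemma hamField_eq_zero_iff (p : ℝ × ℝ) :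
    hamField b a p = 0 ↔ 2 * (b + p.1 ^ 2) * p.2 = p.1 ∧ 2 * (a + p.2 ^ 2) * p.1 = p.2 := by
  rw [Prod.ext_iff]
  simp only [hamField, Prod.fst_zero, Prod.snd_zero]
  constructor <;> rintro ⟨h1, h2⟩ <;> constructor <;> linarith

/-- The fixed points of the map are the critical points of `V`. -/
lemma Gcomp_eq_self_iff (ha : 0 < a) (hb : 0 < b) (p : ℝ × ℝ) :
    Gcomp b a p = p ↔ hamField b a p = 0 := by
  rw [hamField_eq_zero_iff]
  have h1 : a + p.2 ^ 2 ≠ 0 := by positivity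
  have h2 : b + p.1 ^ 2 ≠ 0 := by positivity
  have key : -p.1 + p.2 / (a + p.2 ^ 2) = p.1 ↔ 2 * (a + p.2 ^ 2) * p.1 = p.2 := by
    constructor <;> intro h
    · field_simp at h; linarith
    · field_simp; linarith
  have key2 : -p.2 + p.1 / (b + p.1 ^ 2) = p.2 ↔ 2 * (b + p.1 ^ 2) * p.2 = p.1 := by
    constructor <;> intro h
    · field_simp at h; linarith
    · field_simp; linarith
  rw [← key, ← key2, Prod.ext_iff]
  simp only [Gcomp, Gone, Function.comp_apply]
  constructor
  · rintro ⟨e1, e2⟩; rw [e1] at e2; exact ⟨e2, e1⟩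
  · rintro ⟨e1, e2⟩; rw [e2]; exact ⟨rfl, e1⟩

/-- A nonzero critical point has the ratio and product of coordinates of `P±`. -/
lemma ratio_prod_of_critical (ha : 0 < a) (hb : 0 < b) {p : ℝ × ℝ} (hp : hamField b a p = 0)
    (h0 : p ≠ (0, 0)) : 0 < p.1 * p.2 ∧ √a * p.1 = √b * p.2 ∧
      p.1 * p.2 = 1 / 2 - √a * √b := by
  obtain ⟨e1, e2⟩ := (hamField_eq_zero_iff p).1 hp
  have hα := Real.sqrt_pos.2 ha
  have hβ := Real.sqrt_pos.2 hb
  have s1 := Real.sq_sqrt ha.le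
  have s2 := Real.sq_sqrt hb.le
  have h1 : p.1 ≠ 0 := fun h => h0 (Prod.ext h (by rw [h] at e2; simpa using e2.symm))
  have h2 : p.2 ≠ 0 := fun h => h0 (Prod.ext (by rw [h] at e1; simpa using e1.symm) h)
  have hpos : 0 < p.1 * p.2 := by
    have : 2 * (a + p.2 ^ 2) * p.1 ^ 2 = p.1 * p.2 := by
      linear_combination p.1 * e2
    rw [← this]; positivity
  have hsq : (√a * p.1 - √b * p.2) * (√a * p.1 + √b * p.2) = 0 := by
    linear_combination p.1 ^ 2 * s1 - p.2 ^ 2 * s2 + p.1 * e2 / 2 - p.2 * e1 / 2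
  have hne : √a * p.1 + √b * p.2 ≠ 0 := by
    intro h
    have : (√a * p.1) * (√b * p.2) = -(√a * p.1) ^ 2 := by linear_combination √a * p.1 * h
    have h3 : 0 < (√a * √b) * (p.1 * p.2) := by positivity
    nlinarith [sq_nonneg (√a * p.1)]
  have hr : √a * p.1 = √b * p.2 := by
    rcases mul_eq_zero.1 hsq with h | h
    · linarith
    · exact absurd h hne
  refine ⟨hpos, hr, mul_left_cancel₀ hpos.ne' ?_⟩
  linear_combination p.1 * e2 / 2 + p.1 ^ 2 * s1 - p.1 * √a * hr

/-- Off the origin, critical points exist only for `ab < 1/4`, and lie on the level `h_min`. -/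
lemma V_of_critical (ha : 0 < a) (hb : 0 < b) {p : ℝ × ℝ} (hp : hamField b a p = 0)
    (h0 : p ≠ (0, 0)) : V b a p = hmin b a := by
  obtain ⟨-, h2, h3⟩ := ratio_prod_of_critical ha hb hp h0
  have := V_sub_hmin ha hb p
  rw [h2, h3] at this
  linarith

lemma hamField_Pplus (ha : 0 < a) (hb : 0 < b) (hab : a * b < 1 / 4) :
    hamField b a (Pplus b a) = 0 := by
  obtain ⟨k1, k2, k3, k4⟩ := Pplus_spec ha hb hab
  have s1 := Real.sq_sqrt ha.le
  have s2 := Real.sq_sqrt hb.le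
  rw [hamField_eq_zero_iff]
  constructor
  · linear_combination -2 * (Pplus b a).2 * s2 - 2 * √b * k3 + 2 * (Pplus b a).1 * k4
  · linear_combination -2 * (Pplus b a).1 * s1 + 2 * √a * k3 + 2 * (Pplus b a).2 * k4

lemma hamField_ne_zero_of_pos {p : ℝ × ℝ} (hV : 0 < V b a p) :
    hamField b a p ≠ 0 := by
  intro h
  obtain ⟨e1, e2⟩ := (hamField_eq_zero_iff p).1 h
  have : V b a p = -(p.1 ^ 2 * p.2 ^ 2) := by
    rw [V]; linear_combination p.1 * e2 / 2 + p.2 * e1 / 2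
  nlinarith [mul_nonneg (sq_nonneg p.1) (sq_nonneg p.2)]

lemma V_pos_of_ne_zero (ha : 0 < a) (hb : 0 < b) (hab : 1 / 4 ≤ a * b) {p : ℝ × ℝ}
    (hp : p ≠ (0, 0)) : 0 < V b a p := by
  by_contra! hV
  refine hp (eq_zero_of_fst_eq_zero hb hV ?_)
  by_contra h1
  have e : 4 * b * V b a p =
      (2 * b * p.2 - p.1) ^ 2 + (4 * (a * b) - 1) * p.1 ^ 2 + 4 * b * (p.1 ^ 2 * p.2 ^ 2) := by
    rw [V]; ring
  have t1 : 0 ≤ (4 * (a * b) - 1) * p.1 ^ 2 := mul_nonneg (by linarith) (sq_nonneg _)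
  have t2 := sq_nonneg (2 * b * p.2 - p.1)
  have t3 : 0 ≤ p.1 ^ 2 * p.2 ^ 2 := by positivity
  have t4 : b * V b a p ≤ 0 := mul_nonpos_of_nonneg_of_nonpos hb.le hV
  have t5 : b * (p.1 ^ 2 * p.2 ^ 2) ≤ 0 := by nlinarith
  have t6 : p.1 ^ 2 * p.2 ^ 2 = 0 := by nlinarith
  have h2 : p.2 = 0 := by simpa [h1] using t6
  rw [h2] at e t2
  have : 0 < p.1 ^ 2 := by positivity
  nlinarith

/-! ### Surrounding -/

/-- An open bounded set whose frontier lies in `C` contains every component of the complement of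
`C` that it meets. -/
lemma surrounds_of_open {C U S : Set (ℝ × ℝ)} (hU : IsOpen U) (hb : Bornology.IsBounded U)
    (hcl : closure U ⊆ U ∪ C) (hd : Disjoint U C) (hS : S ⊆ U) : Surrounds C S := by
  intro p hp
  have hpC : p ∉ C := Set.disjoint_left.1 hd (hS hp)
  refine ⟨hpC, hb.subset ?_⟩
  refine isPreconnected_connectedComponentIn.subset_of_closure_inter_subset hU
    ⟨p, mem_connectedComponentIn hpC, hS hp⟩ ?_
  rintro q ⟨h1, h2⟩
  exact (hcl h1).resolve_right (connectedComponentIn_subset _ _ h2)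

/-- A level set of `V` surrounds the corresponding open sublevel set. -/
lemma surrounds_level (ha : 0 < a) (hb : 0 < b) {h : ℝ} {S : Set (ℝ × ℝ)}
    (hS : ∀ p ∈ S, V b a p < h) : Surrounds (level b a h) S := by
  refine surrounds_of_open (U := {p | V b a p < h})
    (isOpen_lt (continuous_V b a) continuous_const)
    ((isBounded_sublevel ha hb h).subset fun p (hp : V b a p < h) => show V b a p ≤ h from hp.le)
    ?_ ?_ hS
  · intro p hp
    have : V b a p ≤ h := closure_lt_subset_le (continuous_V b a) continuous_const hp
    exact this.lt_or_eq
  · exact Set.disjoint_left.2 fun p (hp : _ < _) hq => hp.ne hq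

/-- For `h < 0`, the right half of the level surrounds the corresponding part of the open
sublevel set: the closure of the latter does not meet the vertical axis. -/
lemma surrounds_rightLevel (ha : 0 < a) (hb : 0 < b) {h : ℝ} (h0 : h < 0) {p : ℝ × ℝ}
    (hp : V b a p < h) (h1 : 0 < p.1) : Surrounds (rightLevel b a h) {p} := by
  refine surrounds_of_open (U := {p | V b a p < h} ∩ {p | 0 < p.1})
    ((isOpen_lt (continuous_V b a) continuous_const).inter
      (isOpen_lt continuous_const continuous_fst))
    ((isBounded_sublevel ha hb h).subset fun p hp => show V b a p ≤ h from le_of_lt hp.1) ?_ ?_ ?_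
  · intro q hq
    have hV : V b a q ≤ h := closure_lt_subset_le (continuous_V b a) continuous_const
      (closure_mono inter_subset_left hq)
    have h2 : 0 ≤ q.1 := closure_lt_subset_le continuous_const continuous_fst
      (closure_mono inter_subset_right hq)
    have h3 : 0 < q.1 := by
      refine h2.lt_of_ne' fun h3 => ?_
      have := eq_zero_of_fst_eq_zero hb (hV.trans h0.le) h3
      rw [this] at hV
      simp [V] at hV
      linarith
    rcases hV.lt_or_eq with h4 | h4
    · exact Or.inl ⟨h4, h3⟩
    · exact Or.inr ⟨h4, h3⟩
  · exact Set.disjoint_left.2 fun p hp hq => (ne_of_lt hp.1) hq.1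
  · rintro _ rfl
    exact ⟨hp, h1⟩

/-- The closed left half-plane is connected, unbounded, and avoids `rightLevel`. -/
lemma not_surrounds_rightLevel (b a h : ℝ) {p : ℝ × ℝ} (hp : p.1 ≤ 0) :
    ¬ Surrounds (rightLevel b a h) {p} := by
  intro hs
  obtain ⟨-, hbd⟩ := hs p rfl
  have hconv : Convex ℝ {q : ℝ × ℝ | q.1 ≤ 0} :=
    convex_halfSpace_le (IsLinearMap.mk (fun _ _ => rfl) (fun _ _ => rfl)) 0
  have hsub : {q : ℝ × ℝ | q.1 ≤ 0} ⊆ connectedComponentIn (rightLevel b a h)ᶜ p :=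
    hconv.isPreconnected.subset_connectedComponentIn hp
      fun q (hq : _ ≤ _) hq' => absurd hq'.2 (not_lt.2 hq)
  obtain ⟨R, hR⟩ := (hbd.subset hsub).exists_norm_le
  have h1 := hR ((0 : ℝ), |R| + 1) (by simp)
  have h2 := (norm_snd_le ((0 : ℝ), |R| + 1)).trans h1
  rw [Real.norm_eq_abs, abs_of_pos (by positivity)] at h2
  linarith [le_abs_self R]

/-! ### Conjugacy to a rotation on closed level curves -/

lemma ConjRotationOn.diffeoCircle {G : ℝ × ℝ → ℝ × ℝ} {C : Set (ℝ × ℝ)}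
    (h : ConjRotationOn G C) : DiffeoCircle C :=
  let ⟨γ, hγ, _⟩ := h
  ⟨γ, hγ⟩

lemma invariant_range_of_semiconj {G : ℝ × ℝ → ℝ × ℝ} {γ : ℝ → ℝ × ℝ} {θ : ℝ}
    (h : ∀ t, G (γ t) = γ (t + θ)) : Invariant G (range γ) := by
  ext p
  constructor
  · rintro ⟨_, ⟨t, rfl⟩, rfl⟩
    exact ⟨t + θ, (h t).symm⟩
  · rintro ⟨t, rfl⟩
    exact ⟨_, ⟨t - θ, rfl⟩, by rw [h, sub_add_cancel]⟩

lemma ConjRotationOn.invariant {G : ℝ × ℝ → ℝ × ℝ} {C : Set (ℝ × ℝ)}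
    (h : ConjRotationOn G C) : Invariant G C := by
  obtain ⟨γ, hγ, θ, hθ⟩ := h
  exact hγ.range_eq ▸ invariant_range_of_semiconj hθ

lemma ConjTranslationOn.diffeoLine {G : ℝ × ℝ → ℝ × ℝ} {L : Set (ℝ × ℝ)}
    (h : ConjTranslationOn G L) : DiffeoLine L :=
  let ⟨γ, hγ, _⟩ := h
  ⟨γ, hγ⟩

lemma ConjTranslationOn.invariant {G : ℝ × ℝ → ℝ × ℝ} {L : Set (ℝ × ℝ)}
    (h : ConjTranslationOn G L) : Invariant G L := by
  obtain ⟨γ, hγ, τ, -, hτ⟩ := h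
  exact hγ.range_eq ▸ invariant_range_of_semiconj hτ

/-- A positive smooth `1`-periodic density of total mass one is the derivative of a smooth
diffeomorphism of the line that commutes with integer translations. -/
lemma exists_circle_change {w : ℝ → ℝ} (hw : ContDiff ℝ ∞ w) (hpos : ∀ t, 0 < w t)
    (hper : ∀ t, w (t + 1) = w t) (hint : ∫ t in (0 : ℝ)..1, w t = 1) :
    ∃ s : ℝ ≃ₜ ℝ, (∀ t, HasDerivAt s (w t) t) ∧ ContDiff ℝ ∞ s.symm ∧
      ∀ t, ∀ n : ℤ, s (t + n) = s t + n := by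
  set f : ℝ → ℝ := fun t => ∫ u in (0 : ℝ)..t, w u with hf
  have hd : ∀ t, HasDerivAt f (w t) t := fun t =>
    intervalIntegral.integral_hasDerivAt_right (hw.continuous.intervalIntegrable _ _)
      (hw.continuous.stronglyMeasurableAtFilter _ _) hw.continuous.continuousAt
  have hmono : StrictMono f := strictMono_of_deriv_pos fun t => by rw [(hd t).deriv]; exact hpos t
  have hadd : ∀ t, f (t + 1) = f t + 1 := fun t => by
    have h1 := intervalIntegral.integral_add_adjacent_intervals
      (hw.continuous.intervalIntegrable (μ := MeasureTheory.volume) 0 t)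
      (hw.continuous.intervalIntegrable t (t + 1))
    have h2 := Function.Periodic.intervalIntegral_add_eq (f := w) hper t 0
    rw [zero_add, hint] at h2
    simp only [hf, ← h1, h2]
  let F : CircleDeg1Lift := ⟨⟨f, hmono.monotone⟩, hadd⟩
  have hcont : Continuous f := continuous_iff_continuousAt.2 fun t => (hd t).continuousAt
  have hsurj : Function.Surjective f := hcont.surjective F.tendsto_atTop F.tendsto_atBot
  let s : ℝ ≃ₜ ℝ := (hmono.orderIsoOfSurjective f hsurj).toHomeomorph
  have hs : (s : ℝ → ℝ) = f := rfl
  have hder : deriv f = w := funext fun t => (hd t).deriv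
  have hsm : ContDiff ℝ ∞ f :=
    contDiff_infty_iff_deriv.2 ⟨fun t => (hd t).differentiableAt, hder ▸ hw⟩
  exact ⟨s, hd, s.contDiff_symm_deriv (fun t => (hpos t).ne') hd hsm, fun t n => F.map_add_int t n⟩

/-- A curve moving in a level set of `V` is everywhere tangent to the Hamiltonian field. -/
lemma exists_smul_hamField {γ : ℝ → ℝ × ℝ} (hγ : ContDiff ℝ ∞ γ) {h : ℝ}
    (hV : ∀ t, V b a (γ t) = h) (hX : ∀ t, hamField b a (γ t) ≠ 0) :
    ∃ w : ℝ → ℝ, ContDiff ℝ ∞ w ∧ ∀ t, deriv γ t = w t • hamField b a (γ t) := by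
  set X := fun t => hamField b a (γ t) with hXdef
  have hXs : ContDiff ℝ ∞ X := (contDiff_hamField b a).comp hγ
  have hD : ContDiff ℝ ∞ (deriv γ) := (contDiff_infty_iff_deriv.1 hγ).2
  have hpos : ∀ t, (X t).1 ^ 2 + (X t).2 ^ 2 ≠ 0 := fun t h0 => hX t <| by
    have h1 : (X t).1 = 0 := by nlinarith [sq_nonneg (X t).1, sq_nonneg (X t).2]
    have h2 : (X t).2 = 0 := by nlinarith [sq_nonneg (X t).1, sq_nonneg (X t).2]
    exact Prod.ext h1 h2
  -- the coefficient of `γ'` along `X` for the Euclidean inner product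
  refine ⟨fun t => ((deriv γ t).1 * (X t).1 + (deriv γ t).2 * (X t).2) /
    ((X t).1 ^ 2 + (X t).2 ^ 2), ?_, fun t => ?_⟩
  · have h1 := hD.fst
    have h2 := hD.snd
    have h3 := hXs.fst
    have h4 := hXs.snd
    exact ((h1.mul h3).add (h2.mul h4)).div ((h3.pow 2).add (h4.pow 2)) hpos
  · have hd : HasDerivAt γ (deriv γ t) t :=
      ((contDiff_infty_iff_deriv.1 hγ).1 t).hasDerivAt
    have h1 : HasDerivAt (fun t => (γ t).1) (deriv γ t).1 t := hd.fst
    have h2 : HasDerivAt (fun t => (γ t).2) (deriv γ t).2 t := hd.snd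
    have h3 := ((((h1.pow 2).const_mul a).add ((h2.pow 2).const_mul b)).sub (h1.mul h2)).add
      ((h1.pow 2).mul (h2.pow 2))
    have h4 : HasDerivAt (fun t => V b a (γ t)) 0 t := by
      rw [funext hV]; exact hasDerivAt_const t h
    have h5 := h3.unique h4
    have hperp : (deriv γ t).1 * (X t).2 - (deriv γ t).2 * (X t).1 = 0 := by
      simp only [hXdef, hamField]
      simp at h5
      linear_combination -h5
    have hp := hpos t
    ext
    · simp only [Prod.smul_fst, smul_eq_mul]
      change _ = _ * (X t).1
      field_simp
      linear_combination (X t).2 * hperp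
    · simp only [Prod.smul_snd, smul_eq_mul]
      change _ = _ * (X t).2
      field_simp
      linear_combination -(X t).1 * hperp

/-- A closed curve inside a level set of `V` and free of critical points can be parametrized
by the time of the Hamiltonian flow, up to a constant factor. -/
lemma exists_hamiltonian_param {C : Set (ℝ × ℝ)} (hC : DiffeoCircle C) {h : ℝ}
    (hV : ∀ p ∈ C, V b a p = h) (hX : ∀ p ∈ C, hamField b a p ≠ 0) :
    ∃ γ, IsCircleParam γ C ∧ ∃ T : ℝ, ∀ t, HasDerivAt γ (T • hamField b a (γ t)) t := by
  obtain ⟨γ, hγ⟩ := hC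
  have hmem : ∀ t, γ t ∈ C := fun t => hγ.range_eq ▸ mem_range_self t
  obtain ⟨w, hw, hwX⟩ := exists_smul_hamField hγ.smooth (fun t => hV _ (hmem t))
    fun t => hX _ (hmem t)
  have hw0 : ∀ t, w t ≠ 0 := fun t h0 => hγ.regular t (by rw [hwX, h0, zero_smul])
  have hγ1 : ∀ t, γ (t + 1) = γ t := fun t => ((hγ.eq_iff _ _).2 ⟨1, by simp⟩).symm
  have hper : ∀ t, w (t + 1) = w t := fun t => by
    have h1 : deriv γ (t + 1) = deriv γ t := by
      rw [← deriv_comp_add_const, funext hγ1]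
    rw [hwX, hwX, hγ1] at h1
    exact smul_left_injective ℝ (hX _ (hmem t)) h1
  set T := ∫ t in (0 : ℝ)..1, w t with hT
  -- `w` has constant sign, which is also the sign of its mean `T`
  have hpos : ∀ t, 0 < w t / T := by
    have hsign : (∀ t, 0 < w t) ∨ ∀ t, w t < 0 := by
      by_contra! hcon
      obtain ⟨⟨t, ht⟩, u, hu⟩ := hcon
      obtain ⟨z, hz⟩ := mem_range_of_exists_le_of_exists_ge hw.continuous ⟨t, ht⟩ ⟨u, hu⟩
      exact hw0 z hz
    rcases hsign with hs | hs
    · have : 0 < T := intervalIntegral.intervalIntegral_pos_of_pos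
        (hw.continuous.intervalIntegrable _ _) hs one_pos
      exact fun t => div_pos (hs t) this
    · have : 0 < -T := by
        rw [hT, ← intervalIntegral.integral_neg]
        exact intervalIntegral.intervalIntegral_pos_of_pos
          (hw.continuous.neg.intervalIntegrable _ _) (fun t => neg_pos.2 (hs t)) one_pos
      exact fun t => div_pos_of_neg_of_neg (hs t) (by linarith)
  have hT0 : T ≠ 0 := fun h0 => by have := hpos 0; rw [h0, div_zero] at this; exact lt_irrefl _ this
  -- the normalized flow time `s`, along which the speed is the constant `T`
  obtain ⟨s, hs, hsm, hsn⟩ := exists_circle_change (hw.div_const T) hpos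
    (fun t => by rw [hper]) (by rw [intervalIntegral.integral_div, ← hT, div_self hT0])
  have hder : ∀ t, HasDerivAt (fun t => γ (s.symm t)) (T • hamField b a (γ (s.symm t))) t := by
    intro t
    have h1 : HasDerivAt s.symm (w (s.symm t) / T)⁻¹ t :=
      HasDerivAt.of_local_left_inverse s.symm.continuous.continuousAt (hs _) (hpos _).ne'
        (Eventually.of_forall s.apply_symm_apply)
    have h2 : HasDerivAt γ (deriv γ (s.symm t)) (s.symm t) :=
      ((contDiff_infty_iff_deriv.1 hγ.smooth).1 _).hasDerivAt
    refine (h2.scomp t h1).congr_deriv ?_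
    rw [hwX, smul_smul]
    congr 1
    have := hw0 (s.symm t)
    field_simp
  refine ⟨fun t => γ (s.symm t), ⟨hγ.smooth.comp hsm, fun t => ?_, fun u t => ?_, ?_⟩, T, hder⟩
  · rw [(hder t).deriv]
    exact smul_ne_zero hT0 (hX _ (hmem _))
  · rw [hγ.eq_iff]
    refine exists_congr fun n => ?_
    rw [← s.injective.eq_iff, hsn, s.apply_symm_apply, s.apply_symm_apply]
  · rw [← hγ.range_eq]
    exact s.symm.surjective.range_comp γ

/-- On a closed curve without critical points inside a level set, the map commutes with the
Hamiltonian flow, hence is a translation of the time parameter by uniqueness of solutions. -/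
lemma conjRotationOn_of_diffeoCircle (ha : 0 < a) (hb : 0 < b) {C : Set (ℝ × ℝ)}
    (hC : DiffeoCircle C) {h : ℝ} (hV : ∀ p ∈ C, V b a p = h)
    (hX : ∀ p ∈ C, hamField b a p ≠ 0) (hG : MapsTo (Gcomp b a) C C) :
    ConjRotationOn (Gcomp b a) C := by
  obtain ⟨γ, hγ, T, hder⟩ := exists_hamiltonian_param hC hV hX
  have hmem : ∀ t, γ t ∈ C := fun t => hγ.range_eq ▸ mem_range_self t
  obtain ⟨θ, hθ⟩ : Gcomp b a (γ 0) ∈ range γ := hγ.range_eq ▸ hG (hmem 0)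
  refine ⟨γ, hγ, θ, ?_⟩
  obtain ⟨K, hK⟩ := LocallyLipschitzOn.exists_lipschitzOnWith_of_compact
    (isCompact_sublevel ha hb h) (f := fun p => T • hamField b a p)
    (((contDiff_hamField b a).const_smul T).of_le (by norm_cast)).locallyLipschitz.locallyLipschitzOn
  have := ODE_solution_unique_univ (v := fun _ p => T • hamField b a p)
    (s := fun _ => {p | V b a p ≤ h}) (f := fun t => Gcomp b a (γ t)) (g := fun t => γ (t + θ))
    (t₀ := 0) (K := K) (fun _ => hK)
    (fun t => ⟨hasDerivAt_Gcomp_comp ha hb (hder t), (hV _ (hG (hmem t))).le⟩)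
    (fun t => ⟨(hder (t + θ)).comp_add_const t θ, (hV _ (hmem _)).le⟩) (by simp [hθ])
  exact fun t => congrFun this t

/-! ### Explicit parametrizations of the closed level curves -/

lemma cos_sin_two_pi_eq_iff (s t : ℝ) :
    (Real.cos (2 * Real.pi * s) = Real.cos (2 * Real.pi * t) ∧
      Real.sin (2 * Real.pi * s) = Real.sin (2 * Real.pi * t)) ↔ ∃ n : ℤ, t = s + n := by
  have hpi := Real.pi_ne_zero
  constructor
  · rintro ⟨h1, h2⟩
    obtain ⟨k, hk⟩ := Real.Angle.angle_eq_iff_two_pi_dvd_sub.1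
      (Real.Angle.cos_sin_inj h1.symm h2.symm)
    refine ⟨k, mul_left_cancel₀ (mul_ne_zero two_ne_zero hpi) ?_⟩
    linarith
  · rintro ⟨n, rfl⟩
    rw [show 2 * Real.pi * (s + n) = 2 * Real.pi * s + n * (2 * Real.pi) by ring,
      Real.cos_add_int_mul_two_pi, Real.sin_add_int_mul_two_pi]
    exact ⟨rfl, rfl⟩

lemma exists_cos_sin_two_pi (z : ℂ) :
    ∃ t : ℝ, ‖z‖ * Real.cos (2 * Real.pi * t) = z.re ∧ ‖z‖ * Real.sin (2 * Real.pi * t) = z.im := by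
  refine ⟨z.arg / (2 * Real.pi), ?_⟩
  rw [mul_div_cancel₀ _ (mul_ne_zero two_ne_zero Real.pi_ne_zero)]
  exact ⟨Complex.norm_mul_cos_arg z, Complex.norm_mul_sin_arg z⟩

lemma hasDerivAt_cos_two_pi (t : ℝ) : HasDerivAt (fun t => Real.cos (2 * Real.pi * t))
    (-(2 * Real.pi * Real.sin (2 * Real.pi * t))) t := by
  have := (Real.hasDerivAt_cos (2 * Real.pi * t)).comp t ((hasDerivAt_id t).const_mul _)
  exact this.congr_deriv (by ring)

lemma hasDerivAt_sin_two_pi (t : ℝ) : HasDerivAt (fun t => Real.sin (2 * Real.pi * t))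
    (2 * Real.pi * Real.cos (2 * Real.pi * t)) t := by
  have := (Real.hasDerivAt_sin (2 * Real.pi * t)).comp t ((hasDerivAt_id t).const_mul _)
  exact this.congr_deriv (by ring)

/-- A closed curve given in polar coordinates by a smooth positive periodic radius. -/
lemma isCircleParam_polar {R : ℝ → ℝ} (hR : ContDiff ℝ ∞ R) (hpos : ∀ t, 0 < R t)
    (hper : ∀ t, ∀ n : ℤ, R (t + n) = R t) :
    IsCircleParam (fun t => (R t * Real.cos (2 * Real.pi * t), R t * Real.sin (2 * Real.pi * t)))
      (range fun t => (R t * Real.cos (2 * Real.pi * t), R t * Real.sin (2 * Real.pi * t))) := by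
  refine ⟨?_, fun t h0 => ?_, fun s t => ?_, rfl⟩
  · fun_prop
  · have hd : HasDerivAt R (deriv R t) t := ((contDiff_infty_iff_deriv.1 hR).1 t).hasDerivAt
    have h1 := (hd.mul (hasDerivAt_cos_two_pi t)).prodMk (hd.mul (hasDerivAt_sin_two_pi t))
    have h2 := h1.deriv.symm.trans h0
    rw [Prod.ext_iff] at h2
    obtain ⟨e1, e2⟩ := h2
    simp only [Prod.fst_zero, Prod.snd_zero] at e1 e2
    have hcs := Real.sin_sq_add_cos_sq (2 * Real.pi * t)
    have : R t * (2 * Real.pi) = 0 := by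
      linear_combination Real.cos (2 * Real.pi * t) * e2 - Real.sin (2 * Real.pi * t) * e1 -
        R t * (2 * Real.pi) * hcs
    exact mul_ne_zero (hpos t).ne' (mul_ne_zero two_ne_zero Real.pi_ne_zero) this
  · constructor
    · intro h
      obtain ⟨e1, e2⟩ := Prod.ext_iff.1 h
      simp only at e1 e2
      have h3 : R s = R t := by
        rw [← sq_eq_sq₀ (hpos s).le (hpos t).le]
        have c1 := Real.sin_sq_add_cos_sq (2 * Real.pi * s)
        have c2 := Real.sin_sq_add_cos_sq (2 * Real.pi * t)
        calc R s ^ 2 = (R s * Real.cos (2 * Real.pi * s)) ^ 2 +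
              (R s * Real.sin (2 * Real.pi * s)) ^ 2 := by linear_combination -R s ^ 2 * c1
          _ = R t ^ 2 := by rw [e1, e2]; linear_combination R t ^ 2 * c2
      rw [h3] at e1 e2
      exact (cos_sin_two_pi_eq_iff s t).1
        ⟨mul_left_cancel₀ (hpos t).ne' e1, mul_left_cancel₀ (hpos t).ne' e2⟩
    · rintro ⟨n, rfl⟩
      obtain ⟨e1, e2⟩ := (cos_sin_two_pi_eq_iff s (s + n)).2 ⟨n, rfl⟩
      simp only [hper, ← e1, ← e2]

/-- A positive level set is star-shaped about the origin: in the direction `(c, s)` the equation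
`V = h` is quadratic in the squared radius and has exactly one positive root. -/
lemma diffeoCircle_level (ha : 0 < a) (hb : 0 < b) {h : ℝ} (hh : 0 < h) :
    DiffeoCircle (level b a h) := by
  set A : ℝ → ℝ := fun t => a * Real.cos (2 * Real.pi * t) ^ 2 +
    b * Real.sin (2 * Real.pi * t) ^ 2 - Real.cos (2 * Real.pi * t) * Real.sin (2 * Real.pi * t)
    with hA
  set B : ℝ → ℝ := fun t => (Real.cos (2 * Real.pi * t) * Real.sin (2 * Real.pi * t)) ^ 2 with hB
  have hB0 : ∀ t, 0 ≤ B t := fun t => sq_nonneg _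
  -- where `A ≤ 0`, the product `cos * sin` does not vanish
  have hAB : ∀ t, A t ≤ 0 → 0 < B t := fun t ht => by
    refine (hB0 t).lt_of_ne' fun h0 => ?_
    have h1 : Real.cos (2 * Real.pi * t) * Real.sin (2 * Real.pi * t) = 0 := by simpa [hB] using h0
    have hcs := Real.sin_sq_add_cos_sq (2 * Real.pi * t)
    simp only [hA, h1] at ht
    nlinarith [mul_nonneg ha.le (sq_nonneg (Real.cos (2 * Real.pi * t))),
      mul_nonneg hb.le (sq_nonneg (Real.sin (2 * Real.pi * t))), mul_pos ha hb]
  -- the discriminant of `A ρ + B ρ² = h`, whose positive root is `ρ = 2h / (A + √D)`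
  have hD : ∀ t, 0 < A t ^ 2 + 4 * B t * h := fun t => by
    rcases le_or_gt (A t) 0 with h1 | h1
    · have := hAB t h1; positivity
    · have := hB0 t; positivity
  have hAD : ∀ t, 0 < A t + √(A t ^ 2 + 4 * B t * h) := fun t => by
    rcases le_or_gt (A t) 0 with h1 | h1
    · have h2 := mul_pos (hAB t h1) hh
      have : -A t < √(A t ^ 2 + 4 * B t * h) := Real.lt_sqrt_of_sq_lt (by linarith)
      linarith
    · positivity
  have hAs : ContDiff ℝ ∞ A := by fun_prop
  have hBs : ContDiff ℝ ∞ B := by fun_prop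
  have hDs : ContDiff ℝ ∞ fun t => √(A t ^ 2 + 4 * B t * h) :=
    ContDiff.sqrt (by fun_prop) fun t => (hD t).ne'
  have hρ : ∀ t, 0 < 2 * h / (A t + √(A t ^ 2 + 4 * B t * h)) := fun t =>
    div_pos (by positivity) (hAD t)
  have hV : ∀ r t : ℝ, V b a (r * Real.cos (2 * Real.pi * t), r * Real.sin (2 * Real.pi * t)) =
      A t * r ^ 2 + B t * (r ^ 2) ^ 2 := fun r t => by simp only [V, hA, hB]; ring
  have hP := isCircleParam_polar (R := fun t => √(2 * h / (A t + √(A t ^ 2 + 4 * B t * h))))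
    (ContDiff.sqrt (contDiff_const.div (hAs.add hDs) fun t => (hAD t).ne') fun t => (hρ t).ne')
    (fun t => Real.sqrt_pos.2 (hρ t)) fun t n => by
      obtain ⟨e1, e2⟩ := (cos_sin_two_pi_eq_iff t (t + n)).2 ⟨n, rfl⟩
      simp only [hA, hB, ← e1, ← e2]
  refine ⟨_, hP.smooth, hP.regular, hP.eq_iff, ?_⟩
  ext p
  constructor
  · rintro ⟨t, rfl⟩
    change V b a _ = h
    rw [hV, Real.sq_sqrt (hρ t).le]
    have h1 := Real.sq_sqrt (hD t).le
    have h2 := (hAD t).ne'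
    set s := √(A t ^ 2 + 4 * B t * h)
    field_simp
    linear_combination -h1
  · intro (hp : V b a p = h)
    obtain ⟨t, h1, h2⟩ := exists_cos_sin_two_pi ⟨p.1, p.2⟩
    set r := ‖(⟨p.1, p.2⟩ : ℂ)‖
    have hpr : p = (r * Real.cos (2 * Real.pi * t), r * Real.sin (2 * Real.pi * t)) :=
      Prod.ext h1.symm h2.symm
    rw [hpr, hV] at hp
    have hr : 0 < r := by
      refine (norm_nonneg _).lt_of_ne' fun (h0 : r = 0) => ?_
      rw [h0] at hp; simp at hp; linarith
    have hroot : 0 < A t + 2 * B t * r ^ 2 := by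
      have : 0 < r ^ 2 * (A t + 2 * B t * r ^ 2) := by
        have : 0 ≤ B t * (r ^ 2) ^ 2 := mul_nonneg (hB0 t) (by positivity)
        nlinarith
      exact pos_of_mul_pos_right this (by positivity)
    have hs : √(A t ^ 2 + 4 * B t * h) = A t + 2 * B t * r ^ 2 := by
      rw [← hp, ← Real.sqrt_sq hroot.le]; congr 1; ring
    have hR : √(2 * h / (A t + √(A t ^ 2 + 4 * B t * h))) = r := by
      rw [← Real.sqrt_sq hr.le]
      congr 1
      rw [div_eq_iff (hAD t).ne', hs, ← hp]; ring
    exact ⟨t, by simp only [hR]; exact hpr.symm⟩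

lemma conjRotationOn_level (ha : 0 < a) (hb : 0 < b) {h : ℝ} (hh : 0 < h) :
    ConjRotationOn (Gcomp b a) (level b a h) :=
  conjRotationOn_of_diffeoCircle ha hb (diffeoCircle_level ha hb hh) (fun _ hp => hp)
    (fun p (hp : V b a p = h) => hamField_ne_zero_of_pos (hh.trans_eq hp.symm))
    fun p (hp : V b a p = h) => (V_Gcomp ha hb p).trans hp

/-- With `x = k e^(f+g)`, `y = l e^(f-g)`, `kl = m`, the level `V = -m²` becomes the symmetric
convex curve `m cosh 2f + √(ab) cosh 2g = 1/2`. -/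
lemma V_exp_eq_iff {α β k l m : ℝ} (hm : 0 < m) (hkl : k * l = m) (hr : α * k = β * l) (f g : ℝ) :
    V (β ^ 2) (α ^ 2) (k * Real.exp (f + g), l * Real.exp (f - g)) = -m ^ 2 ↔
      2 * m * Real.sinh f ^ 2 + 2 * (α * β) * Real.sinh g ^ 2 = 1 / 2 - α * β - m := by
  have hk : α ^ 2 * k ^ 2 = α * β * m := by linear_combination α * k * hr + α * β * hkl
  have hl : β ^ 2 * l ^ 2 = α * β * m := by linear_combination -β * l * hr + α * β * hkl
  have e1 : Real.exp f * Real.exp (-f) = 1 := by rw [← Real.exp_add]; simp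
  have e2 : Real.exp g * Real.exp (-g) = 1 := by rw [← Real.exp_add]; simp
  have key : V (β ^ 2) (α ^ 2) (k * Real.exp (f + g), l * Real.exp (f - g)) + m ^ 2 =
      2 * m * Real.exp f ^ 2 * (2 * m * Real.sinh f ^ 2 + 2 * (α * β) * Real.sinh g ^ 2 -
        (1 / 2 - α * β - m)) := by
    rw [Real.sinh_eq, Real.sinh_eq, sub_eq_add_neg, Real.exp_add, Real.exp_add, V]
    set F := Real.exp f
    set F' := Real.exp (-f)
    set H := Real.exp g
    set H' := Real.exp (-g)
    simp only
    have t1 : k ^ 2 * l ^ 2 = m ^ 2 := by rw [← hkl]; ring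
    linear_combination F ^ 2 * H ^ 2 * hk + F ^ 2 * H' ^ 2 * hl - F ^ 2 * H * H' * hkl +
      F ^ 4 * H ^ 2 * H' ^ 2 * t1 +
      (2 * m ^ 2 * F ^ 2 - m ^ 2 * (1 + F * F')) * e1 +
      (F ^ 4 * m ^ 2 * (1 + H * H') - F ^ 2 * m + 2 * m * F ^ 2 * (α * β)) * e2
  constructor
  · intro h
    rw [h, neg_add_cancel] at key
    have : 2 * m * Real.exp f ^ 2 ≠ 0 := by positivity
    have := (mul_eq_zero.1 key.symm).resolve_left this
    linarith
  · intro h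
    rw [h, sub_self, mul_zero] at key
    linarith

/-- The closed curve `(k e^(f+g), l e^(f-g))` on which `(sinh g / Q, sinh f / P)` runs around the
unit circle. -/
lemma isCircleParam_exp {k l P Q : ℝ} (hk : 0 < k) (hl : 0 < l) (hP : 0 < P) (hQ : 0 < Q) :
    IsCircleParam (fun t => (k * Real.exp (Real.arsinh (P * Real.sin (2 * Real.pi * t)) +
        Real.arsinh (Q * Real.cos (2 * Real.pi * t))),
      l * Real.exp (Real.arsinh (P * Real.sin (2 * Real.pi * t)) -
        Real.arsinh (Q * Real.cos (2 * Real.pi * t)))))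
      (range fun t => (k * Real.exp (Real.arsinh (P * Real.sin (2 * Real.pi * t)) +
        Real.arsinh (Q * Real.cos (2 * Real.pi * t))),
      l * Real.exp (Real.arsinh (P * Real.sin (2 * Real.pi * t)) -
        Real.arsinh (Q * Real.cos (2 * Real.pi * t))))) := by
  have hpi := Real.pi_pos
  have hfs : ContDiff ℝ ∞ fun t => Real.arsinh (P * Real.sin (2 * Real.pi * t)) :=
    Real.contDiff_arsinh.comp (by fun_prop)
  have hgs : ContDiff ℝ ∞ fun t => Real.arsinh (Q * Real.cos (2 * Real.pi * t)) :=
    Real.contDiff_arsinh.comp (by fun_prop)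
  refine ⟨?_, fun t h0 => ?_, fun s t => ?_, rfl⟩
  · exact (contDiff_const.mul (hfs.add hgs).exp).prodMk (contDiff_const.mul (hfs.sub hgs).exp)
  · have hf := ((hasDerivAt_sin_two_pi t).const_mul P).arsinh
    have hg := ((hasDerivAt_cos_two_pi t).const_mul Q).arsinh
    have h2 := (((hf.add hg).exp.const_mul k).prodMk
      ((hf.sub hg).exp.const_mul l)).deriv.symm.trans h0
    obtain ⟨e1, e2⟩ := Prod.ext_iff.1 h2
    simp only [Prod.fst_zero, Prod.snd_zero, mul_eq_zero, hk.ne', hl.ne', Real.exp_ne_zero,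
      false_or] at e1 e2
    have p1 : 0 < (√(1 + (P * Real.sin (2 * Real.pi * t)) ^ 2))⁻¹ := by positivity
    have p2 : 0 < (√(1 + (Q * Real.cos (2 * Real.pi * t)) ^ 2))⁻¹ := by positivity
    simp only [smul_eq_mul] at e1 e2
    set u := (√(1 + (P * Real.sin (2 * Real.pi * t)) ^ 2))⁻¹
    set v := (√(1 + (Q * Real.cos (2 * Real.pi * t)) ^ 2))⁻¹
    have c1 : (u * P * (2 * Real.pi)) * Real.cos (2 * Real.pi * t) = 0 := by
      linear_combination (e1 + e2) / 2
    have c2 : (v * Q * (2 * Real.pi)) * Real.sin (2 * Real.pi * t) = 0 := by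
      linear_combination (e2 - e1) / 2
    have hcs := Real.sin_sq_add_cos_sq (2 * Real.pi * t)
    rw [(mul_eq_zero.1 c1).resolve_left (by positivity),
      (mul_eq_zero.1 c2).resolve_left (by positivity)] at hcs
    norm_num at hcs
  · rw [← cos_sin_two_pi_eq_iff, Prod.ext_iff]
    simp only [mul_right_inj' hk.ne', mul_right_inj' hl.ne', Real.exp_eq_exp]
    constructor
    · rintro ⟨e1, e2⟩
      have e3 := Real.arsinh_injective (show Real.arsinh (P * Real.sin (2 * Real.pi * s)) =
        Real.arsinh (P * Real.sin (2 * Real.pi * t)) by linarith)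
      have e4 := Real.arsinh_injective (show Real.arsinh (Q * Real.cos (2 * Real.pi * s)) =
        Real.arsinh (Q * Real.cos (2 * Real.pi * t)) by linarith)
      exact ⟨mul_left_cancel₀ hQ.ne' e4, mul_left_cancel₀ hP.ne' e3⟩
    · rintro ⟨e1, e2⟩
      rw [e1, e2]
      exact ⟨rfl, rfl⟩

/-- Rescaling `sinh f` and `sinh g` turns the convex curve of `V_exp_eq_iff` into the unit
circle. -/
lemma diffeoCircle_rightLevel (ha : 0 < a) (hb : 0 < b) (hab : a * b < 1 / 4) {h : ℝ} (h0 : h < 0)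
    (hh : hmin b a < h) : DiffeoCircle (rightLevel b a h) := by
  have hc := sqrt_mul_sqrt_lt ha hab
  obtain ⟨α, hα, rfl, hα'⟩ : ∃ α, 0 < α ∧ a = α ^ 2 ∧ √a = α :=
    ⟨√a, Real.sqrt_pos.2 ha, (Real.sq_sqrt ha.le).symm, rfl⟩
  obtain ⟨β, hβ, rfl, hβ'⟩ : ∃ β, 0 < β ∧ b = β ^ 2 ∧ √b = β :=
    ⟨√b, Real.sqrt_pos.2 hb, (Real.sq_sqrt hb.le).symm, rfl⟩
  obtain ⟨m, hm, rfl⟩ : ∃ m, 0 < m ∧ h = -m ^ 2 :=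
    ⟨√(-h), Real.sqrt_pos.2 (by linarith), by rw [Real.sq_sqrt (by linarith)]; ring⟩
  rw [hmin, Real.sqrt_mul ha.le] at hh
  rw [hα', hβ'] at hh hc
  obtain ⟨E, hE, hE'⟩ : ∃ E, 0 < E ∧ E = 1 / 2 - α * β - m := by
    refine ⟨_, sub_pos.2 (lt_of_pow_lt_pow_left₀ 2 (by linarith) ?_), rfl⟩
    nlinarith
  have hk : 0 < √(m * β / α) := Real.sqrt_pos.2 (by positivity)
  have hl : 0 < √(m * α / β) := Real.sqrt_pos.2 (by positivity)
  have hkl : √(m * β / α) * √(m * α / β) = m := by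
    rw [← Real.sqrt_mul (by positivity), show m * β / α * (m * α / β) = m ^ 2 by field_simp,
      Real.sqrt_sq hm.le]
  have hr : α * √(m * β / α) = β * √(m * α / β) := by
    rw [← sq_eq_sq₀ (by positivity) (by positivity), mul_pow, mul_pow,
      Real.sq_sqrt (by positivity), Real.sq_sqrt (by positivity)]
    field_simp
  set k := √(m * β / α)
  set l := √(m * α / β)
  have hP : 0 < √(E / (2 * m)) := Real.sqrt_pos.2 (by positivity)
  have hQ : 0 < √(E / (2 * (α * β))) := Real.sqrt_pos.2 (by positivity)
  have hP2 : 2 * m * √(E / (2 * m)) ^ 2 = E := by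
    rw [Real.sq_sqrt (by positivity)]; field_simp
  have hQ2 : 2 * (α * β) * √(E / (2 * (α * β))) ^ 2 = E := by
    rw [Real.sq_sqrt (by positivity)]; field_simp
  set P := √(E / (2 * m))
  set Q := √(E / (2 * (α * β)))
  have hΓ := isCircleParam_exp hk hl hP hQ
  refine ⟨_, hΓ.smooth, hΓ.regular, hΓ.eq_iff, ?_⟩
  ext p
  constructor
  · rintro ⟨t, rfl⟩
    refine ⟨(V_exp_eq_iff hm hkl hr _ _).2 ?_, by positivity⟩
    have hcs := Real.sin_sq_add_cos_sq (2 * Real.pi * t)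
    rw [Real.sinh_arsinh, Real.sinh_arsinh, ← hE']
    linear_combination Real.sin (2 * Real.pi * t) ^ 2 * hP2 +
      Real.cos (2 * Real.pi * t) ^ 2 * hQ2 + E * hcs
  · rintro ⟨hV, h1⟩
    have h2 := snd_pos_of_V_nonpos ha hb (hV.trans_le h0.le) h1
    set f := (Real.log (p.1 / k) + Real.log (p.2 / l)) / 2 with hf
    set g := (Real.log (p.1 / k) - Real.log (p.2 / l)) / 2 with hg
    have e1 : k * Real.exp (f + g) = p.1 := by
      rw [show f + g = Real.log (p.1 / k) by rw [hf, hg]; ring, Real.exp_log (by positivity)]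
      field_simp
    have e2 : l * Real.exp (f - g) = p.2 := by
      rw [show f - g = Real.log (p.2 / l) by rw [hf, hg]; ring, Real.exp_log (by positivity)]
      field_simp
    have hp : p = (k * Real.exp (f + g), l * Real.exp (f - g)) := Prod.ext e1.symm e2.symm
    rw [hp, V_exp_eq_iff hm hkl hr, ← hE'] at hV
    have hnorm : ‖(⟨Real.sinh g / Q, Real.sinh f / P⟩ : ℂ)‖ = 1 := by
      rw [← sq_eq_sq₀ (norm_nonneg _) zero_le_one, Complex.sq_norm, Complex.normSq_mk]
      field_simp
      apply mul_left_cancel₀ (mul_pos (mul_pos (mul_pos two_pos hm) (mul_pos hα hβ)) two_pos).ne'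
      linear_combination 2 * (α * β) * Real.sinh g ^ 2 * hP2 + 2 * m * Real.sinh f ^ 2 * hQ2 +
        E * hV - E * hP2 - 2 * m * P ^ 2 * hQ2
    obtain ⟨t, ht1, ht2⟩ := exists_cos_sin_two_pi ⟨Real.sinh g / Q, Real.sinh f / P⟩
    rw [hnorm, one_mul] at ht1 ht2
    refine ⟨t, ?_⟩
    simp only [ht1, ht2]
    rw [mul_div_cancel₀ _ hP.ne', mul_div_cancel₀ _ hQ.ne', Real.arsinh_sinh, Real.arsinh_sinh]
    exact hp.symm

lemma conjRotationOn_rightLevel (ha : 0 < a) (hb : 0 < b) (hab : a * b < 1 / 4) {h : ℝ}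
    (h0 : h < 0) (hh : hmin b a < h) : ConjRotationOn (Gcomp b a) (rightLevel b a h) :=
  conjRotationOn_of_diffeoCircle ha hb (diffeoCircle_rightLevel ha hb hab h0 hh)
    (fun _ hp => hp.1)
    (fun p hp hX => hh.ne' (hp.1.symm.trans (V_of_critical ha hb hX
      fun h => by simp [rightLevel, h] at hp)))
    (mapsTo_rightLevel ha hb h0.le)

/-! ### The homoclinic loops -/

/-- The homoclinic orbit as a pair of shifted hyperbolic secants. With
`cosh d = 1 / (2αβ)` the map `G_a`, `a = α²`, acts on it as a shift by `d` which exchanges `α`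
and `β`. -/
noncomputable def soliton (α β d t : ℝ) : ℝ × ℝ :=
  (β * Real.sinh d / Real.cosh t, α * Real.sinh d / Real.cosh (t + d))

lemma Gone_soliton {α β d : ℝ} (hα : 0 < α) (hd : 2 * (α * β) * Real.cosh d = 1)
    (t : ℝ) : Gone (α ^ 2) (soliton α β d t) = soliton β α d (t + d) := by
  have h1 := (Real.cosh_pos t).ne'
  have h2 := (Real.cosh_pos (t + d)).ne'
  have h3 := (Real.cosh_pos (t + d + d)).ne'
  have e1 : Real.cosh (t + d + d) + Real.cosh t = 2 * Real.cosh (t + d) * Real.cosh d := by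
    have := Real.cosh_sub (t + d) d
    rw [add_sub_cancel_right] at this
    rw [this, Real.cosh_add (t + d) d]; ring
  have e2 : Real.cosh (t + d + d) * Real.cosh t = Real.cosh (t + d) ^ 2 + Real.sinh d ^ 2 := by
    have := Real.cosh_sub (t + d) d
    rw [add_sub_cancel_right] at this
    rw [this, Real.cosh_add (t + d) d]
    linear_combination Real.cosh (t + d) ^ 2 * Real.cosh_sq d -
      Real.sinh d ^ 2 * Real.sinh_sq (t + d)
  have h4 : α ^ 2 + (α * Real.sinh d / Real.cosh (t + d)) ^ 2 =
      α ^ 2 * (Real.cosh (t + d + d) * Real.cosh t) / Real.cosh (t + d) ^ 2 := by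
    rw [e2]; field_simp
  refine Prod.ext rfl ?_
  simp only [Gone, soliton]
  rw [h4]
  field_simp
  linear_combination -Real.sinh d * α * β * e1 - Real.cosh (t + d) * Real.sinh d * hd

lemma Gcomp_soliton {α β d : ℝ} (hα : 0 < α) (hβ : 0 < β)
    (hd : 2 * (α * β) * Real.cosh d = 1) (t : ℝ) :
    Gcomp (β ^ 2) (α ^ 2) (soliton α β d t) = soliton α β d (t + 2 * d) := by
  rw [Gcomp, Function.comp_apply, Gone_soliton hα hd, Gone_soliton hβ (by rwa [mul_comm β α])]
  congr 1; ring

/-- The time parameter on the homoclinic orbit, as a function of the point. -/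
lemma arsinh_soliton {α β d : ℝ} (hα : 0 < α) (hβ : 0 < β) (hd : 0 < d) (t : ℝ) :
    Real.arsinh (α / (soliton α β d t).2 - Real.cosh d * (β / (soliton α β d t).1)) = t := by
  rw [← Real.arsinh_sinh t]
  congr 1
  have h1 := (Real.cosh_pos t).ne'
  have h2 := (Real.cosh_pos (t + d)).ne'
  have h3 := (Real.sinh_pos_iff.2 hd).ne'
  rw [Real.arsinh_sinh]
  simp only [soliton]
  rw [Real.cosh_add] at *
  field_simp
  ring

lemma isLineParam_soliton {α β d : ℝ} (hα : 0 < α) (hβ : 0 < β) (hd : 0 < d)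
    (hc : 2 * (α * β) * Real.cosh d = 1) :
    IsLineParam (soliton α β d) (rightLevel (β ^ 2) (α ^ 2) 0) := by
  have hS := Real.sinh_pos_iff.2 hd
  have hsm : ContDiff ℝ ∞ (soliton α β d) :=
    (contDiff_const.div Real.contDiff_cosh fun t => (Real.cosh_pos t).ne').prodMk
      (contDiff_const.div (Real.contDiff_cosh.comp (contDiff_id.add contDiff_const))
        fun t => (Real.cosh_pos _).ne')
  have hx : ∀ t, 0 < (soliton α β d t).1 := fun t => by
    have := Real.cosh_pos t; simp only [soliton]; positivity
  have hy : ∀ t, 0 < (soliton α β d t).2 := fun t => by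
    have := Real.cosh_pos (t + d); simp only [soliton]; positivity
  refine ⟨hsm, fun t h0 => ?_, ⟨?_, ?_⟩, ?_⟩
  · have h1 := (Real.hasDerivAt_cosh t).fun_inv (Real.cosh_pos t).ne'
    have h2 := ((Real.hasDerivAt_cosh (t + d)).comp_add_const t d).fun_inv (Real.cosh_pos _).ne'
    have h3 := ((h1.const_mul (β * Real.sinh d)).prodMk
      (h2.const_mul (α * Real.sinh d))).deriv.symm.trans h0
    obtain ⟨e1, e2⟩ := Prod.ext_iff.1 h3
    have p1 := (Real.cosh_pos t).ne'
    have p2 := (Real.cosh_pos (t + d)).ne'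
    simp [hα.ne', hβ.ne', hd.ne', p1, p2] at e1 e2
    exact hd.ne' (by linarith)
  -- the explicit time parameter is a left inverse, continuous on the curve
  · refine isInducing_iff_nhds.2 fun t => le_antisymm
      (hsm.continuous.continuousAt.tendsto.le_comap) ?_
    have hg : ContinuousAt
        (fun p : ℝ × ℝ => Real.arsinh (α / p.2 - Real.cosh d * (β / p.1))) (soliton α β d t) :=
      Real.continuous_arsinh.continuousAt.comp
        ((continuousAt_const.div continuousAt_snd (hy t).ne').sub
          (continuousAt_const.mul (continuousAt_const.div continuousAt_fst (hx t).ne')))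
    have h1 := hg.tendsto
    rw [arsinh_soliton hα hβ hd] at h1
    calc comap (soliton α β d) (𝓝 (soliton α β d t))
        ≤ comap (soliton α β d) (comap _ (𝓝 t)) := comap_mono h1.le_comap
      _ = 𝓝 t := by
          rw [comap_comap]
          convert comap_id using 2
          exact funext fun u => arsinh_soliton hα hβ hd u
  · intro s t hst
    rw [← arsinh_soliton hα hβ hd s, hst, arsinh_soliton hα hβ hd]
  · ext p
    constructor
    · rintro ⟨t, rfl⟩
      refine ⟨?_, hx t⟩
      have h1 := (Real.cosh_pos t).ne'
      have h2 := (Real.cosh_pos (t + d)).ne'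
      have h3 := Real.cosh_sq t
      have h4 := Real.cosh_sq d
      have e1 := Real.cosh_add t d
      -- with `1 = 2αβ cosh d`, the equation `V = 0` is this addition theorem
      have key : Real.cosh t ^ 2 + Real.cosh (t + d) ^ 2 -
          2 * Real.cosh d * Real.cosh t * Real.cosh (t + d) + Real.sinh d ^ 2 = 0 := by
        rw [e1]
        linear_combination -Real.cosh t ^ 2 * h4 - Real.sinh d ^ 2 * h3
      simp only [V, soliton]
      field_simp
      linear_combination α * β * Real.sinh d ^ 2 * (α * β * key + Real.cosh t * Real.cosh (t + d) * hc)
    · rintro ⟨hV, h1⟩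
      have h2 := snd_pos_of_V_nonpos (by positivity) (by positivity) hV.le h1
      have hcosh : Real.cosh (Real.arsinh (α / p.2 - Real.cosh d * (β / p.1))) =
          β * Real.sinh d / p.1 := by
        rw [Real.cosh_arsinh, ← Real.sqrt_sq (show 0 ≤ β * Real.sinh d / p.1 by positivity)]
        congr 1
        have h4 := Real.cosh_sq d
        simp only [V] at hV
        field_simp
        linear_combination hV + p.2 ^ 2 * β ^ 2 * h4 - p.1 * p.2 * hc
      refine ⟨Real.arsinh (α / p.2 - Real.cosh d * (β / p.1)), Prod.ext ?_ ?_⟩ <;>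
        simp only [soliton]
      · rw [hcosh]; field_simp
      · rw [Real.cosh_add, hcosh, Real.sinh_arsinh]; field_simp; ring

lemma tendsto_inv_cosh_atTop : Tendsto (fun t => (Real.cosh t)⁻¹) atTop (𝓝 0) := by
  refine tendsto_inv_atTop_zero.comp (tendsto_atTop_mono (fun t => ?_)
    (Real.tendsto_exp_atTop.atTop_div_const two_pos))
  rw [Real.cosh_eq]
  linarith [Real.exp_pos (-t)]

lemma tendsto_inv_cosh_atBot : Tendsto (fun t => (Real.cosh t)⁻¹) atBot (𝓝 0) := by
  simpa [Function.comp_def] using tendsto_inv_cosh_atTop.comp tendsto_neg_atBot_atTop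

lemma tendsto_soliton {α β d : ℝ} {u : ℕ → ℝ}
    (hu : Tendsto u atTop atTop ∨ Tendsto u atTop atBot) :
    Tendsto (fun n => soliton α β d (u n)) atTop (𝓝 (0, 0)) := by
  have h : Tendsto (fun n => (Real.cosh (u n))⁻¹) atTop (𝓝 0) ∧
      Tendsto (fun n => (Real.cosh (u n + d))⁻¹) atTop (𝓝 0) := by
    rcases hu with hu | hu
    · exact ⟨tendsto_inv_cosh_atTop.comp hu,
        tendsto_inv_cosh_atTop.comp (tendsto_atTop_add_const_right _ d hu)⟩
    · exact ⟨tendsto_inv_cosh_atBot.comp hu,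
        tendsto_inv_cosh_atBot.comp (tendsto_atBot_add_const_right _ d hu)⟩
  simp only [soliton, div_eq_mul_inv]
  have := (h.1.const_mul (β * Real.sinh d)).prodMk_nhds (h.2.const_mul (α * Real.sinh d))
  simpa using this

/-- Since `√(ab) < 1/2`, the equation `cosh d = 1 / (2√(ab))` has a positive solution. -/
lemma exists_soliton (ha : 0 < a) (hb : 0 < b) (hab : a * b < 1 / 4) :
    ∃ α β d : ℝ, 0 < α ∧ 0 < β ∧ 0 < d ∧ a = α ^ 2 ∧ b = β ^ 2 ∧
      2 * (α * β) * Real.cosh d = 1 := by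
  have hα := Real.sqrt_pos.2 ha
  have hβ := Real.sqrt_pos.2 hb
  have hc := sqrt_mul_sqrt_lt ha hab
  have h1 : 1 < 1 / (2 * (√a * √b)) := by
    rw [lt_div_iff₀ (by positivity)]; linarith
  refine ⟨√a, √b, Real.arcosh (1 / (2 * (√a * √b))), hα, hβ, Real.arcosh_pos h1,
    (Real.sq_sqrt ha.le).symm, (Real.sq_sqrt hb.le).symm, ?_⟩
  rw [Real.cosh_arcosh h1.le]
  field_simp

lemma conjTranslationOn_rightLevel (ha : 0 < a) (hb : 0 < b) (hab : a * b < 1 / 4) :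
    ConjTranslationOn (Gcomp b a) (rightLevel b a 0) := by
  obtain ⟨α, β, d, hα, hβ, hd, rfl, rfl, hc⟩ := exists_soliton ha hb hab
  exact ⟨_, isLineParam_soliton hα hβ hd hc, 2 * d, by positivity, Gcomp_soliton hα hβ hc⟩

/-- The loop is the part of the compact level `V = 0` in the closed right half-plane. -/
lemma isCompact_insert_rightLevel (ha : 0 < a) (hb : 0 < b) :
    IsCompact (insert ((0, 0) : ℝ × ℝ) (rightLevel b a 0)) := by
  have h : insert ((0, 0) : ℝ × ℝ) (rightLevel b a 0) =
      {p | V b a p ≤ 0} ∩ ({p | V b a p = 0} ∩ {p | 0 ≤ p.1}) := by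
    ext p
    constructor
    · rintro (rfl | ⟨h1, h2⟩)
      · simp [V]
      · exact ⟨h1.le, h1, h2.le⟩
    · rintro ⟨-, h1, h2⟩
      rcases eq_or_lt_of_le (show 0 ≤ p.1 from h2) with h3 | h3
      · exact Or.inl (eq_zero_of_fst_eq_zero hb (le_of_eq h1) h3.symm)
      · exact Or.inr ⟨h1, h3⟩
  rw [h]
  exact (isCompact_sublevel ha hb 0).inter_right
    ((isClosed_eq (continuous_V b a) continuous_const).inter
      (isClosed_le continuous_const continuous_fst))

/-! ### Symmetry under the central reflection -/

lemma IsCircleParam.neg {γ : ℝ → ℝ × ℝ} {C : Set (ℝ × ℝ)} (h : IsCircleParam γ C) :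
    IsCircleParam (fun t => -γ t) (-C) where
  smooth := h.smooth.neg
  regular t := by rw [deriv.fun_neg]; exact neg_ne_zero.2 (h.regular t)
  eq_iff s t := by rw [neg_inj, h.eq_iff]
  range_eq := by rw [← h.range_eq, ← Set.image_neg_eq_neg, ← range_comp]; rfl

lemma IsLineParam.neg {γ : ℝ → ℝ × ℝ} {L : Set (ℝ × ℝ)} (h : IsLineParam γ L) :
    IsLineParam (fun t => -γ t) (-L) where
  smooth := h.smooth.neg
  regular t := by rw [deriv.fun_neg]; exact neg_ne_zero.2 (h.regular t)
  embedding := (Homeomorph.neg (ℝ × ℝ)).isEmbedding.comp h.embedding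
  range_eq := by rw [← h.range_eq, ← Set.image_neg_eq_neg, ← range_comp]; rfl

lemma ConjRotationOn.neg {C : Set (ℝ × ℝ)} (h : ConjRotationOn (Gcomp b a) C) :
    ConjRotationOn (Gcomp b a) (-C) := by
  obtain ⟨γ, hγ, θ, hθ⟩ := h
  exact ⟨_, hγ.neg, θ, fun t => by rw [Gcomp_neg, hθ]⟩

lemma ConjTranslationOn.neg {L : Set (ℝ × ℝ)} (h : ConjTranslationOn (Gcomp b a) L) :
    ConjTranslationOn (Gcomp b a) (-L) := by
  obtain ⟨γ, hγ, τ, h0, hτ⟩ := h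
  exact ⟨_, hγ.neg, τ, h0, fun t => by rw [Gcomp_neg, hτ]⟩

lemma Surrounds.neg {C : Set (ℝ × ℝ)} {p : ℝ × ℝ} (h : Surrounds C {p}) :
    Surrounds (-C) {-p} := by
  rintro _ rfl
  obtain ⟨h1, h2⟩ := h p rfl
  refine ⟨by simpa using h1, ?_⟩
  have := (Homeomorph.neg (ℝ × ℝ)).image_connectedComponentIn (s := Cᶜ) (x := p) h1
  rw [Homeomorph.coe_neg, Set.image_neg_eq_neg, Set.image_neg_eq_neg, Set.compl_neg] at this
  rw [← this]
  exact h2.neg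

/-! ### The stable and unstable manifolds of the origin -/

/-- A sequence on one level of `V` that tends to the origin lies on the level zero. -/
lemma V_eq_zero_of_tendsto {u : ℕ → ℝ × ℝ} {p : ℝ × ℝ}
    (hu : Tendsto u atTop (𝓝 (0, 0))) (hV : ∀ n, V b a (u n) = V b a p) : V b a p = 0 := by
  have h1 := ((continuous_V b a).tendsto (0, 0)).comp hu
  simp only [Function.comp_def, hV] at h1
  simpa [V] using tendsto_nhds_unique tendsto_const_nhds h1

lemma rightLevel_subset_stableSet (ha : 0 < a) (hb : 0 < b) (hab : a * b < 1 / 4) :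
    rightLevel b a 0 ⊆ stableSet (Gcomp b a) (0, 0) := by
  obtain ⟨α, β, d, hα, hβ, hd, rfl, rfl, hc⟩ := exists_soliton ha hb hab
  rw [← (isLineParam_soliton hα hβ hd hc).range_eq]
  rintro _ ⟨t, rfl⟩
  have h : ∀ n : ℕ, (Gcomp (β ^ 2) (α ^ 2))^[n] (soliton α β d t) =
      soliton α β d (t + n * (2 * d)) := fun n => by
    induction n with
    | zero => simp
    | succ n ih =>
      rw [Function.iterate_succ_apply', ih, Gcomp_soliton hα hβ hc]
      congr 1; push_cast; ring
  change Tendsto _ _ _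
  simp only [h]
  exact tendsto_soliton (Or.inl (tendsto_atTop_add_const_left _ _
    (tendsto_natCast_atTop_atTop.atTop_mul_const (by positivity))))

lemma rightLevel_subset_unstableSet (ha : 0 < a) (hb : 0 < b) (hab : a * b < 1 / 4) :
    rightLevel b a 0 ⊆ unstableSet (Gcomp b a) (0, 0) := by
  obtain ⟨α, β, d, hα, hβ, hd, rfl, rfl, hc⟩ := exists_soliton ha hb hab
  rw [← (isLineParam_soliton hα hβ hd hc).range_eq]
  rintro _ ⟨t, rfl⟩
  refine ⟨fun n => soliton α β d (t + n * (-(2 * d))), by simp, fun n => ?_, ?_⟩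
  · rw [Gcomp_soliton hα hβ hc]
    congr 1; push_cast; ring
  · exact tendsto_soliton (Or.inr (tendsto_atBot_add_const_left _ _
      (tendsto_natCast_atTop_atTop.atTop_mul_const_of_neg (by linarith))))

lemma neg_mem_stableSet {p : ℝ × ℝ} (h : p ∈ stableSet (Gcomp b a) (0, 0)) :
    -p ∈ stableSet (Gcomp b a) (0, 0) := by
  have h1 : ∀ n : ℕ, (Gcomp b a)^[n] (-p) = -(Gcomp b a)^[n] p := fun n => by
    induction n with
    | zero => rfl
    | succ n ih => rw [Function.iterate_succ_apply', ih, Gcomp_neg, Function.iterate_succ_apply']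
  change Tendsto _ _ _ at h
  change Tendsto _ _ _
  simp only [h1]
  simpa using h.neg

lemma neg_mem_unstableSet {p : ℝ × ℝ} (h : p ∈ unstableSet (Gcomp b a) (0, 0)) :
    -p ∈ unstableSet (Gcomp b a) (0, 0) := by
  obtain ⟨u, h0, h1, h2⟩ := h
  exact ⟨fun n => -u n, by simp [h0], fun n => by rw [Gcomp_neg, h1], by simpa using h2.neg⟩

lemma level_zero_eq_stableSet (ha : 0 < a) (hb : 0 < b) (hab : a * b < 1 / 4) :
    level b a 0 \ {((0, 0) : ℝ × ℝ)} = stableSet (Gcomp b a) (0, 0) \ {((0, 0) : ℝ × ℝ)} := by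
  refine Subset.antisymm (fun p hp => ⟨?_, hp.2⟩) fun p hp => ⟨?_, hp.2⟩
  · rw [← rightLevel_union_neg hb le_rfl] at hp
    rcases hp with hp | hp
    · exact rightLevel_subset_stableSet ha hb hab hp
    · simpa using neg_mem_stableSet (rightLevel_subset_stableSet ha hb hab hp)
  · exact V_eq_zero_of_tendsto hp.1 fun n => V_iterate ha hb n p

lemma level_zero_eq_unstableSet (ha : 0 < a) (hb : 0 < b) (hab : a * b < 1 / 4) :
    level b a 0 \ {((0, 0) : ℝ × ℝ)} = unstableSet (Gcomp b a) (0, 0) \ {((0, 0) : ℝ × ℝ)} := by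
  refine Subset.antisymm (fun p hp => ⟨?_, hp.2⟩) fun p hp => ⟨?_, hp.2⟩
  · rw [← rightLevel_union_neg hb le_rfl] at hp
    rcases hp with hp | hp
    · exact rightLevel_subset_unstableSet ha hb hab hp
    · simpa using neg_mem_unstableSet (rightLevel_subset_unstableSet ha hb hab hp)
  · obtain ⟨u, h0, h1, h2⟩ := hp.1
    refine V_eq_zero_of_tendsto h2 fun n => ?_
    induction n with
    | zero => rw [h0]
    | succ n ih => rw [← ih, ← h1 n, V_Gcomp ha hb]

/-! ### The derivative at fixed points -/

/-- The linear map `(ξ, η) ↦ (η, -ξ + r η)`, the form of the derivative of `G_β`. -/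
noncomputable def turn (r : ℝ) : ℝ × ℝ →L[ℝ] ℝ × ℝ :=
  (ContinuousLinearMap.snd ℝ ℝ ℝ).prod
    (-ContinuousLinearMap.fst ℝ ℝ ℝ + r • ContinuousLinearMap.snd ℝ ℝ ℝ)

lemma hasFDerivAt_Gone (ha : 0 < a) (p : ℝ × ℝ) :
    HasFDerivAt (Gone a) (turn ((a - p.2 ^ 2) / (a + p.2 ^ 2) ^ 2)) p := by
  have h0 : a + p.2 ^ 2 ≠ 0 := by positivity
  have hg : HasDerivAt (fun y : ℝ => y / (a + y ^ 2)) ((a - p.2 ^ 2) / (a + p.2 ^ 2) ^ 2) p.2 := by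
    refine ((hasDerivAt_id p.2).div ((hasDerivAt_pow 2 p.2).const_add a) h0).congr_deriv ?_
    simp
    ring
  have h1 : HasFDerivAt (fun q : ℝ × ℝ => q.1) (ContinuousLinearMap.fst ℝ ℝ ℝ) p := hasFDerivAt_fst
  have h2 : HasFDerivAt (fun q : ℝ × ℝ => q.2) (ContinuousLinearMap.snd ℝ ℝ ℝ) p := hasFDerivAt_snd
  exact h2.prodMk (h1.neg.add (hg.comp_hasFDerivAt p h2))

/-- At a fixed point, `G_a` has second coordinate equal to the first coordinate of the point. -/
lemma hasFDerivAt_Gcomp_of_fixed (ha : 0 < a) (hb : 0 < b) {p : ℝ × ℝ} (hp : Gcomp b a p = p) :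
    HasFDerivAt (Gcomp b a) ((turn ((b - p.1 ^ 2) / (b + p.1 ^ 2) ^ 2)).comp
      (turn ((a - p.2 ^ 2) / (a + p.2 ^ 2) ^ 2))) p := by
  have h : (Gone a p).2 = p.1 := congrArg Prod.fst hp
  have := (hasFDerivAt_Gone hb (Gone a p)).comp p (hasFDerivAt_Gone ha p)
  rwa [h] at this

lemma charpoly_turn_comp (r s : ℝ) :
    ((turn s).comp (turn r) : (ℝ × ℝ) →ₗ[ℝ] (ℝ × ℝ)).charpoly =
      Polynomial.X ^ 2 - Polynomial.C (s * r - 2) * Polynomial.X + Polynomial.C 1 := by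
  have h : LinearMap.toMatrix (Module.Basis.finTwoProd ℝ) (Module.Basis.finTwoProd ℝ)
      ((turn s).comp (turn r) : (ℝ × ℝ) →ₗ[ℝ] (ℝ × ℝ)) = !![-1, r; -s, s * r - 1] := by
    ext i j
    fin_cases i <;> fin_cases j <;> (simp [LinearMap.toMatrix_apply, turn]; try ring)
  rw [← LinearMap.charpoly_toMatrix _ (Module.Basis.finTwoProd ℝ), h, Matrix.charpoly_fin_two,
    Matrix.trace_fin_two, Matrix.det_fin_two]
  simp only [Matrix.of_apply, Matrix.cons_val', Matrix.cons_val_zero, Matrix.cons_val_one,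
    Matrix.cons_val_fin_one]
  congr 3
  · congr 1; ring
  · ring

lemma multipliers_of_fixed (ha : 0 < a) (hb : 0 < b) {p : ℝ × ℝ} (hp : Gcomp b a p = p) :
    multipliers (Gcomp b a) p = (Polynomial.X ^ 2 - Polynomial.C
      ((b - p.1 ^ 2) / (b + p.1 ^ 2) ^ 2 * ((a - p.2 ^ 2) / (a + p.2 ^ 2) ^ 2) - 2) *
      Polynomial.X + Polynomial.C 1 : Polynomial ℝ).aroots ℂ := by
  rw [multipliers, (hasFDerivAt_Gcomp_of_fixed ha hb hp).fderiv, charpoly_turn_comp]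

lemma eq_of_mem_aroots {τ : ℝ} {z : ℂ} (hz : z ∈ (Polynomial.X ^ 2 - Polynomial.C τ * Polynomial.X +
    Polynomial.C 1 : Polynomial ℝ).aroots ℂ) : z ^ 2 - τ * z + 1 = 0 := by
  simpa using (Polynomial.mem_aroots.1 hz).2

/-- The roots of `z² - τ z + 1` lie on the unit circle when `|τ| ≤ 2`, and are nonreal
when `|τ| < 2`. -/
lemma norm_eq_one_of_trace {τ : ℝ} {z : ℂ} (hz : z ^ 2 - τ * z + 1 = 0) (h1 : -2 ≤ τ)
    (h2 : τ ≤ 2) : ‖z‖ = 1 ∧ (-2 < τ → τ < 2 → z.im ≠ 0) := by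
  have hre := congrArg Complex.re hz
  have him := congrArg Complex.im hz
  simp [pow_two] at hre him
  have key : (z.re - τ / 2) ^ 2 = z.im ^ 2 + τ ^ 2 / 4 - 1 := by linear_combination hre
  constructor
  · rw [← sq_eq_sq₀ (norm_nonneg _) zero_le_one, Complex.sq_norm, Complex.normSq_apply]
    by_cases hi : z.im = 0
    · rw [hi] at key ⊢
      have h3 : (z.re - τ / 2) ^ 2 = 0 := le_antisymm (by nlinarith) (sq_nonneg _)
      have h4 : z.re = τ / 2 := by nlinarith
      have h5 : τ ^ 2 = 4 := by nlinarith
      rw [h4]; linarith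
    · have h3 : τ = 2 * z.re := by
        apply mul_left_cancel₀ hi; linarith
      rw [h3] at hre
      linarith
  · intro h3 h4 hi
    rw [hi] at key
    nlinarith [sq_nonneg (z.re - τ / 2)]

lemma norm_multiplier_eq_one (ha : 0 < a) (hb : 0 < b) {p : ℝ × ℝ} (hp : Gcomp b a p = p) {τ : ℝ}
    (hτ : (b - p.1 ^ 2) / (b + p.1 ^ 2) ^ 2 * ((a - p.2 ^ 2) / (a + p.2 ^ 2) ^ 2) - 2 = τ)
    (h1 : -2 ≤ τ) (h2 : τ ≤ 2) : ∀ z ∈ multipliers (Gcomp b a) p, ‖z‖ = 1 := fun z hz => by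
  rw [multipliers_of_fixed ha hb hp, hτ] at hz
  exact (norm_eq_one_of_trace (eq_of_mem_aroots hz) h1 h2).1

lemma trace_zero (a b : ℝ) :
    (b - ((0, 0) : ℝ × ℝ).1 ^ 2) / (b + ((0, 0) : ℝ × ℝ).1 ^ 2) ^ 2 *
      ((a - ((0, 0) : ℝ × ℝ).2 ^ 2) / (a + ((0, 0) : ℝ × ℝ).2 ^ 2) ^ 2) - 2 =
        1 / (a * b) - 2 := by
  rcases eq_or_ne a 0 with rfl | ha
  · simp
  rcases eq_or_ne b 0 with rfl | hb
  · simp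
  simp
  field_simp

/-- The ingredients of the trace at a nonzero critical point, in terms of `√(ab)`. -/
lemma critical_spec (ha : 0 < a) (hb : 0 < b) {p : ℝ × ℝ} (hp : hamField b a p = 0)
    (h0 : p ≠ (0, 0)) : √a * (b - p.1 ^ 2) = √b * (2 * (√a * √b) - 1 / 2) ∧
      √b * (a - p.2 ^ 2) = √a * (2 * (√a * √b) - 1 / 2) := by
  obtain ⟨-, h2, h3⟩ := ratio_prod_of_critical ha hb hp h0
  have s1 := Real.sq_sqrt ha.le
  have s2 := Real.sq_sqrt hb.le
  constructor
  · linear_combination -√a * s2 - p.1 * h2 - √b * h3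
  · linear_combination -√b * s1 + p.2 * h2 - √a * h3

lemma trace_critical (ha : 0 < a) (hb : 0 < b) {p : ℝ × ℝ} (hp : hamField b a p = 0)
    (h0 : p ≠ (0, 0)) :
    (b - p.1 ^ 2) / (b + p.1 ^ 2) ^ 2 * ((a - p.2 ^ 2) / (a + p.2 ^ 2) ^ 2) - 2 =
      4 * (4 * (√a * √b) - 1) ^ 2 - 2 := by
  obtain ⟨e1, e2⟩ := (hamField_eq_zero_iff p).1 hp
  obtain ⟨f1, f2⟩ := critical_spec ha hb hp h0
  have hpos := (ratio_prod_of_critical ha hb hp h0).1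
  have hα := Real.sqrt_pos.2 ha
  have hβ := Real.sqrt_pos.2 hb
  -- the product of the two critical point equations
  have hden : (b + p.1 ^ 2) * (a + p.2 ^ 2) = 1 / 4 := by
    apply mul_left_cancel₀ hpos.ne'
    linear_combination p.2 / 4 * e1 + (b + p.1 ^ 2) * p.2 / 2 * e2
  have hnum : (b - p.1 ^ 2) * (a - p.2 ^ 2) = (2 * (√a * √b) - 1 / 2) ^ 2 := by
    apply mul_left_cancel₀ (mul_pos hα hβ).ne'
    linear_combination √b * (a - p.2 ^ 2) * f1 + √b * (2 * (√a * √b) - 1 / 2) * f2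
  rw [div_mul_div_comm, ← mul_pow, hden, hnum]
  ring

lemma isElliptic_of_trace (ha : 0 < a) (hb : 0 < b) {p : ℝ × ℝ} (hp : Gcomp b a p = p) {τ : ℝ}
    (hτ : (b - p.1 ^ 2) / (b + p.1 ^ 2) ^ 2 * ((a - p.2 ^ 2) / (a + p.2 ^ 2) ^ 2) - 2 = τ)
    (h1 : -2 < τ) (h2 : τ < 2) : IsElliptic (Gcomp b a) p where
  fixed := hp
  diff := (hasFDerivAt_Gcomp_of_fixed ha hb hp).differentiableAt
  eigen z hz := by
    rw [multipliers_of_fixed ha hb hp, hτ] at hz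
    have := norm_eq_one_of_trace (eq_of_mem_aroots hz) h1.le h2.le
    exact ⟨this.1, this.2 h1 h2⟩

lemma isHyperbolicSaddle_zero (ha : 0 < a) (hb : 0 < b) (hab : a * b < 1 / 4) :
    IsHyperbolicSaddle (Gcomp b a) (0, 0) where
  fixed := Gcomp_zero b a
  diff := (hasFDerivAt_Gcomp_of_fixed ha hb (Gcomp_zero b a)).differentiableAt
  eigen := by
    rw [multipliers_of_fixed ha hb (Gcomp_zero b a)]
    rw [trace_zero]
    have h4 : 4 < 1 / (a * b) := by rw [lt_div_iff₀ (by positivity)]; linarith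
    set τ := 1 / (a * b) - 2
    have hd : 0 < τ ^ 2 - 4 := by nlinarith
    have hs := Real.sq_sqrt hd.le
    have hs0 := Real.sqrt_pos.2 hd
    set s := √(τ ^ 2 - 4)
    have hν : 1 < (τ + s) / 2 := by linarith
    have hprod : (τ - s) / 2 * ((τ + s) / 2) = 1 := by linear_combination -hs / 4
    have hμ0 : 0 < (τ - s) / 2 := by
      by_contra! h; nlinarith
    refine ⟨(τ - s) / 2, (τ + s) / 2, ?_, by rwa [abs_of_pos (by linarith)], ?_⟩
    · rw [abs_of_pos hμ0]; nlinarith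
    · have hfac : (Polynomial.X ^ 2 - Polynomial.C τ * Polynomial.X + Polynomial.C 1 :
          Polynomial ℝ) = (Polynomial.X - Polynomial.C ((τ - s) / 2)) *
            (Polynomial.X - Polynomial.C ((τ + s) / 2)) := by
        rw [← hprod, show τ = (τ - s) / 2 + (τ + s) / 2 by ring]
        simp only [Polynomial.C_add, Polynomial.C_mul]
        ring_nf
      rw [hfac, Polynomial.aroots_mul (mul_ne_zero (Polynomial.X_sub_C_ne_zero _)
        (Polynomial.X_sub_C_ne_zero _)), Polynomial.aroots_X_sub_C, Polynomial.aroots_X_sub_C]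
      rfl

/-! ### Centers -/

/-- Near a strict minimum on a compact set, low values force closeness to the minimum. -/
lemma exists_sublevel_subset {f : ℝ × ℝ → ℝ} (hf : Continuous f) {K U : Set (ℝ × ℝ)}
    (hK : IsCompact K) {p : ℝ × ℝ} (hU : U ∈ 𝓝 p) (hmin : ∀ q ∈ K, q ≠ p → f p < f q) :
    ∃ c, f p < c ∧ ∀ q ∈ K, f q < c → q ∈ U := by
  have hK' : IsCompact (K \ interior U) := hK.diff isOpen_interior
  have hp : p ∈ interior U := mem_interior_iff_mem_nhds.2 hU
  rcases (K \ interior U).eq_empty_or_nonempty with he | hne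
  · refine ⟨f p + 1, by linarith, fun q hq _ => ?_⟩
    by_contra hqU
    exact notMem_empty q (he ▸ ⟨hq, fun h => hqU (interior_subset h)⟩)
  · obtain ⟨r, hr, hrmin⟩ := hK'.exists_isMinOn hne hf.continuousOn
    refine ⟨f r, hmin r hr.1 (fun h => hr.2 (h ▸ hp)), fun q hq hlt => ?_⟩
    by_contra hqU
    exact hlt.not_ge (hrmin ⟨hq, fun h => hqU (interior_subset h)⟩)

lemma isElliptic_zero (ha : 0 < a) (hb : 0 < b) (hab : 1 / 4 < a * b) :
    IsElliptic (Gcomp b a) (0, 0) := by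
  have h4 : 1 / (a * b) < 4 := by rw [div_lt_iff₀ (by positivity)]; linarith
  have h5 : 0 < 1 / (a * b) := by positivity
  exact isElliptic_of_trace ha hb (Gcomp_zero b a) (trace_zero a b) (by linarith) (by linarith)

/-- For `ab ≥ 1/4` the origin is the strict minimum of `V`, and positive levels are closed curves. -/
lemma isEllipticType_zero (ha : 0 < a) (hb : 0 < b) (hab : 1 / 4 ≤ a * b) :
    IsEllipticType (Gcomp b a) (0, 0) where
  fixed := Gcomp_zero b a
  diff := (hasFDerivAt_Gcomp_of_fixed ha hb (Gcomp_zero b a)).differentiableAt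
  eigen := by
    have h4 : 1 / (a * b) ≤ 4 := by rw [div_le_iff₀ (by positivity)]; linarith
    have h5 : 0 < 1 / (a * b) := by positivity
    exact norm_multiplier_eq_one ha hb (Gcomp_zero b a) (trace_zero a b) (by linarith) (by linarith)
  center U hU := by
    have hV0 : V b a (0, 0) = 0 := by simp [V]
    obtain ⟨c, hc, hcU⟩ := exists_sublevel_subset (continuous_V b a) (isCompact_sublevel ha hb 1) hU
      fun q _ hq => hV0.trans_lt (V_pos_of_ne_zero ha hb hab hq)
    rw [hV0] at hc
    refine ⟨{p | V b a p < min c 1}, (isOpen_lt (continuous_V b a) continuous_const).mem_nhds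
      (by change V b a (0, 0) < _; rw [hV0]; exact lt_min hc one_pos), fun q hq h0 => ?_⟩
    have hq : V b a q < min c 1 := hq
    have hpos := V_pos_of_ne_zero ha hb hab h0
    have hrot := conjRotationOn_level ha hb hpos
    refine ⟨level b a (V b a q), fun r (hr : V b a r = V b a q) => hcU r ?_ ?_, rfl,
      hrot.diffeoCircle, hrot.invariant, surrounds_level ha hb ?_⟩
    · exact (hr.trans_lt (hq.trans_le (min_le_right _ _))).le
    · exact hr.trans_lt (hq.trans_le (min_le_left _ _))
    · rintro _ rfl
      rwa [hV0]

/-- `P₊` is the strict minimum of `V` on the right half of `V ≤ 0`, filled by closed curves. -/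
lemma center_Pplus (ha : 0 < a) (hb : 0 < b) (hab : a * b < 1 / 4) {U : Set (ℝ × ℝ)}
    (hU : U ∈ 𝓝 (Pplus b a)) : ∃ W ∈ 𝓝 (Pplus b a), ∀ q ∈ W, q ≠ Pplus b a →
      ∃ C ⊆ U, q ∈ C ∧ DiffeoCircle C ∧ Invariant (Gcomp b a) C ∧ Surrounds C {Pplus b a} := by
  have hVP := V_Pplus ha hb hab
  have hP1 := (Pplus_spec ha hb hab).1
  have hmin0 : hmin b a < 0 := by
    rw [hmin, Real.sqrt_mul ha.le]
    have h1 := sqrt_mul_sqrt_lt ha hab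
    have h2 : a * b = (√a * √b) ^ 2 := by rw [mul_pow, Real.sq_sqrt ha.le, Real.sq_sqrt hb.le]
    rw [h2]
    nlinarith [mul_pos (sub_pos.2 h1) (sub_pos.2 h1)]
  have hlt : ∀ q : ℝ × ℝ, 0 ≤ q.1 → q ≠ Pplus b a → hmin b a < V b a q := fun q hq hne => by
    refine (hmin_le_V ha hb q).lt_of_ne fun h => hne ?_
    refine eq_Pplus_of_V_eq ha hb hab (hq.lt_of_ne' fun h1 => ?_) h.symm
    have := eq_zero_of_fst_eq_zero hb (h.symm.trans_lt hmin0).le h1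
    rw [this] at h
    simp [V] at h
    linarith
  obtain ⟨c, hc, hcU⟩ := exists_sublevel_subset (continuous_V b a)
    ((isCompact_sublevel ha hb 0).inter_right
      (isClosed_le (continuous_const (y := (0 : ℝ))) continuous_fst)) hU
    fun q hq hne => hVP ▸ hlt q hq.2 hne
  rw [hVP] at hc
  refine ⟨{p | V b a p < min c 0} ∩ {p | 0 < p.1},
    ((isOpen_lt (continuous_V b a) continuous_const).inter
      (isOpen_lt continuous_const continuous_fst)).mem_nhds
      ⟨by change V b a _ < _; rw [hVP]; exact lt_min hc hmin0, hP1⟩, fun q hq hne => ?_⟩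
  have hq1 : V b a q < min c 0 := hq.1
  have hq2 : 0 < q.1 := hq.2
  have hq0 := hq1.trans_le (min_le_right _ _)
  have hq3 := hlt q hq2.le hne
  have hrot := conjRotationOn_rightLevel ha hb hab hq0 hq3
  refine ⟨rightLevel b a (V b a q), fun r hr => hcU r ⟨?_, hr.2.le⟩ ?_, ⟨rfl, hq2⟩,
    hrot.diffeoCircle, hrot.invariant, surrounds_rightLevel ha hb hq0 (hVP ▸ hq3) hP1⟩
  · exact (hr.1.trans_lt hq0).le
  · exact hr.1.trans_lt (hq1.trans_le (min_le_left _ _))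

lemma center_Pminus (ha : 0 < a) (hb : 0 < b) (hab : a * b < 1 / 4) {U : Set (ℝ × ℝ)}
    (hU : U ∈ 𝓝 (Pminus b a)) : ∃ W ∈ 𝓝 (Pminus b a), ∀ q ∈ W, q ≠ Pminus b a →
      ∃ C ⊆ U, q ∈ C ∧ DiffeoCircle C ∧ Invariant (Gcomp b a) C ∧ Surrounds C {Pminus b a} := by
  rw [Pminus_eq] at *
  obtain ⟨W, hW, h⟩ := center_Pplus ha hb hab (U := Neg.neg ⁻¹' U)
    (continuous_neg.continuousAt.preimage_mem_nhds hU)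
  refine ⟨Neg.neg ⁻¹' W, continuous_neg.continuousAt.preimage_mem_nhds (by simpa using hW),
    fun q hq hne => ?_⟩
  obtain ⟨C, hCU, hqC, ⟨γ, hγ⟩, hinv, hs⟩ := h (-q) hq fun h => hne (by rw [← h, neg_neg])
  refine ⟨-C, Set.neg_subset.2 hCU, by simpa using hqC, ⟨_, hγ.neg⟩, ?_, hs.neg⟩
  rw [Invariant, ← Set.image_neg_eq_neg, image_image]
  simp only [Gcomp_neg]
  rw [← image_image (fun x => -x), hinv]

/-- Ellipticity at `P±`: the trace is `-2` exactly for `ab = 1/16`, and then both factors of the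
derivative are quarter turns. -/
lemma isEllipticType_of_critical (ha : 0 < a) (hb : 0 < b) (hab : a * b < 1 / 4) {p : ℝ × ℝ}
    (hp : hamField b a p = 0) (h0 : p ≠ (0, 0)) (hc : ∀ U ∈ 𝓝 p, ∃ W ∈ 𝓝 p, ∀ q ∈ W, q ≠ p →
      ∃ C ⊆ U, q ∈ C ∧ DiffeoCircle C ∧ Invariant (Gcomp b a) C ∧ Surrounds C {p}) :
    IsEllipticType (Gcomp b a) p ∧ (a * b ≠ 1 / 16 → IsElliptic (Gcomp b a) p) ∧
      (a * b = 1 / 16 → fderiv ℝ (Gcomp b a) p = -ContinuousLinearMap.id ℝ (ℝ × ℝ)) := by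
  have hfix := (Gcomp_eq_self_iff ha hb p).2 hp
  have hd := hasFDerivAt_Gcomp_of_fixed ha hb hfix
  have htr := trace_critical ha hb hp h0
  have h1 := sqrt_mul_sqrt_lt ha hab
  have h2 : 0 < √a * √b := mul_pos (Real.sqrt_pos.2 ha) (Real.sqrt_pos.2 hb)
  have h3 : a * b = (√a * √b) ^ 2 := by rw [mul_pow, Real.sq_sqrt ha.le, Real.sq_sqrt hb.le]
  have hlt : 4 * (4 * (√a * √b) - 1) ^ 2 - 2 < 2 := by nlinarith
  have hge : -2 ≤ 4 * (4 * (√a * √b) - 1) ^ 2 - 2 := by nlinarith [sq_nonneg (4 * (√a * √b) - 1)]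
  refine ⟨⟨hfix, hd.differentiableAt, norm_multiplier_eq_one ha hb hfix htr hge hlt.le, hc⟩,
    fun hne => isElliptic_of_trace ha hb hfix htr (hge.lt_of_ne fun h => hne ?_) hlt, fun heq => ?_⟩
  · have h4 : (4 * (√a * √b) - 1) ^ 2 = 0 := by linarith
    have h5 : 4 * (√a * √b) - 1 = 0 := by simpa using h4
    rw [h3, show √a * √b = 1 / 4 by linarith]; norm_num
  · have h4 : √a * √b = 1 / 4 := by
      rw [← sq_eq_sq₀ h2.le (by norm_num), ← h3, heq]; norm_num
    obtain ⟨f1, f2⟩ := critical_spec ha hb hp h0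
    rw [h4] at f1 f2
    norm_num [(Real.sqrt_pos.2 ha).ne', (Real.sqrt_pos.2 hb).ne'] at f1 f2
    rw [hd.fderiv, f1, f2]
    ext <;> simp [turn]

end PlanarDynamics

theorem theorem1 (a b : ℝ) (ha : 0 < a) (hb : 0 < b) :
    (1 / 4 ≤ a * b →
      Function.fixedPoints (Gcomp b a) = {((0, 0) : ℝ × ℝ)} ∧
      IsEllipticType (Gcomp b a) (0, 0) ∧
      (1 / 4 < a * b → IsElliptic (Gcomp b a) (0, 0)) ∧
      ∀ h : ℝ, 0 < h →
        Surrounds (level b a h) {((0, 0) : ℝ × ℝ)} ∧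
        DiffeoCircle (level b a h) ∧
        Invariant (Gcomp b a) (level b a h) ∧
        ConjRotationOn (Gcomp b a) (level b a h)) ∧
    (a * b < 1 / 4 →
      -- the saddle and its two homoclinic loops
      (IsHyperbolicSaddle (Gcomp b a) (0, 0) ∧
        level b a 0 \ {((0, 0) : ℝ × ℝ)} =
          stableSet (Gcomp b a) (0, 0) \ {((0, 0) : ℝ × ℝ)} ∧
        level b a 0 \ {((0, 0) : ℝ × ℝ)} =
          unstableSet (Gcomp b a) (0, 0) \ {((0, 0) : ℝ × ℝ)} ∧
        ∃ L₁ L₂ : Set (ℝ × ℝ),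
          Disjoint L₁ L₂ ∧ L₁ ∪ L₂ = level b a 0 \ {((0, 0) : ℝ × ℝ)} ∧
          ∀ L ∈ ({L₁, L₂} : Set (Set (ℝ × ℝ))),
            DiffeoLine L ∧ IsCompact (insert ((0, 0) : ℝ × ℝ) L) ∧
            Invariant (Gcomp b a) L ∧ ConjTranslationOn (Gcomp b a) L) ∧
      -- the positive levels
      (∀ h : ℝ, 0 < h →
        DiffeoCircle (level b a h) ∧
        Surrounds (level b a h) {p | V b a p ≤ 0} ∧
        Invariant (Gcomp b a) (level b a h) ∧
        ConjRotationOn (Gcomp b a) (level b a h)) ∧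
      -- the nonzero fixed points
      (Function.fixedPoints (Gcomp b a) = {((0, 0) : ℝ × ℝ), Pplus b a, Pminus b a} ∧
        V b a (Pplus b a) = hmin b a ∧ V b a (Pminus b a) = hmin b a ∧
        ∀ P ∈ ({Pplus b a, Pminus b a} : Set (ℝ × ℝ)),
          P ≠ (0, 0) ∧ IsEllipticType (Gcomp b a) P ∧
          (a * b ≠ 1 / 16 → IsElliptic (Gcomp b a) P) ∧
          (a * b = 1 / 16 →
            fderiv ℝ (Gcomp b a) P = -ContinuousLinearMap.id ℝ (ℝ × ℝ))) ∧
      -- the negative levels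
      ((∀ h : ℝ, h < hmin b a → level b a h = ∅) ∧
        ∀ h : ℝ, hmin b a < h → h < 0 →
          ∃ C₁ C₂ : Set (ℝ × ℝ),
            Disjoint C₁ C₂ ∧ C₁ ∪ C₂ = level b a h ∧
            Surrounds C₁ {Pplus b a} ∧ ¬ Surrounds C₁ {Pminus b a} ∧
            Surrounds C₂ {Pminus b a} ∧ ¬ Surrounds C₂ {Pplus b a} ∧
            ∀ C ∈ ({C₁, C₂} : Set (Set (ℝ × ℝ))),
              DiffeoCircle C ∧ Invariant (Gcomp b a) C ∧ ConjRotationOn (Gcomp b a) C)) := by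
  refine ⟨fun hab => ⟨?_, isEllipticType_zero ha hb hab, isElliptic_zero ha hb, fun h hh => ?_⟩,
    fun hab => ⟨⟨isHyperbolicSaddle_zero ha hb hab, level_zero_eq_stableSet ha hb hab,
      level_zero_eq_unstableSet ha hb hab, rightLevel b a 0, -rightLevel b a 0,
      disjoint_rightLevel_neg b a 0, rightLevel_union_neg hb le_rfl, ?_⟩, fun h hh => ?_,
      ⟨?_, V_Pplus ha hb hab, ?_, ?_⟩, fun h hh => ?_, fun h hh h0 => ?_⟩⟩
  · ext p
    rw [Function.mem_fixedPoints, Function.IsFixedPt, mem_singleton_iff]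
    refine ⟨fun hp => ?_, fun hp => hp ▸ Gcomp_zero b a⟩
    by_contra hne
    have h1 := ratio_prod_of_critical ha hb ((Gcomp_eq_self_iff ha hb p).1 hp) hne
    -- a nonzero fixed point would need `xy = 1/2 - √(ab) > 0`
    have h2 : 1 / 2 ≤ √a * √b := by
      rw [← Real.sqrt_mul ha.le]
      exact Real.le_sqrt_of_sq_le (by linarith)
    linarith [h1.1, h1.2.2]
  · have hrot := conjRotationOn_level ha hb hh
    refine ⟨surrounds_level ha hb ?_, hrot.diffeoCircle, hrot.invariant, hrot⟩
    rintro _ rfl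
    simpa [V] using hh
  · have hconj := conjTranslationOn_rightLevel ha hb hab
    have hcpt := isCompact_insert_rightLevel ha hb
    rintro L (rfl | rfl)
    · exact ⟨hconj.diffeoLine, hcpt, hconj.invariant, hconj⟩
    · refine ⟨hconj.neg.diffeoLine, ?_, hconj.neg.invariant, hconj.neg⟩
      have h1 := hcpt.neg
      rw [← Set.image_neg_eq_neg, image_insert_eq, Set.image_neg_eq_neg] at h1
      simpa using h1
  · have hrot := conjRotationOn_level ha hb hh
    exact ⟨hrot.diffeoCircle, surrounds_level ha hb fun p (hp : V b a p ≤ 0) => hp.trans_lt hh,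
      hrot.invariant, hrot⟩
  · ext p
    rw [Function.mem_fixedPoints, Function.IsFixedPt]
    constructor
    · intro hp
      by_cases h0 : p = (0, 0)
      · exact Or.inl h0
      obtain ⟨h1, h2, h3⟩ := ratio_prod_of_critical ha hb ((Gcomp_eq_self_iff ha hb p).1 hp) h0
      rcases lt_or_gt_of_ne (left_ne_zero_of_mul h1.ne') with h4 | h4
      · refine Or.inr (Or.inr ?_)
        have h5 := eq_Pplus ha hb hab (p := -p) (by simpa using h4) (by simpa using h2)
          (by simpa using h3)
        exact neg_eq_iff_eq_neg.1 h5
      · exact Or.inr (Or.inl (eq_Pplus ha hb hab h4 h2 h3))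
    · have h1 := (Gcomp_eq_self_iff ha hb _).2 (hamField_Pplus ha hb hab)
      rintro (rfl | rfl | rfl)
      · exact Gcomp_zero b a
      · exact h1
      · rw [Pminus_eq, Gcomp_neg, h1]
  · rw [Pminus_eq, V_neg, V_Pplus ha hb hab]
  · have hcr := hamField_Pplus ha hb hab
    have h1 := (Pplus_spec ha hb hab).1.ne'
    have hm : hamField b a (Pminus b a) = 0 := by
      rw [← Gcomp_eq_self_iff ha hb, Pminus_eq, Gcomp_neg, (Gcomp_eq_self_iff ha hb _).2 hcr]
    have hne : Pplus b a ≠ (0, 0) := fun h => h1 (congrArg Prod.fst h)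
    have hne' : Pminus b a ≠ (0, 0) := fun h => h1 (neg_eq_zero.1 (congrArg Prod.fst h))
    rintro P (rfl | rfl)
    · exact ⟨hne, isEllipticType_of_critical ha hb hab hcr hne fun U => center_Pplus ha hb hab⟩
    · exact ⟨hne', isEllipticType_of_critical ha hb hab hm hne' fun U => center_Pminus ha hb hab⟩
  · exact eq_empty_of_forall_notMem fun p (hp : V b a p = h) =>
      (hh.trans_le (hmin_le_V ha hb p)).ne' hp
  · have hrot := conjRotationOn_rightLevel ha hb hab h0 hh
    have hP := (Pplus_spec ha hb hab).1
    have hs := surrounds_rightLevel ha hb h0 ((V_Pplus ha hb hab).trans_lt hh) hP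
    have hns := not_surrounds_rightLevel b a h (p := Pminus b a)
      (by rw [Pminus_eq]; exact (neg_neg_of_pos hP).le)
    refine ⟨rightLevel b a h, -rightLevel b a h, disjoint_rightLevel_neg b a h, ?_, hs, hns,
      hs.neg, fun h1 => hns ?_, ?_⟩
    · rw [rightLevel_union_neg hb h0.le]
      exact sdiff_singleton_eq_self fun h1 => h0.ne (by simpa [level, V] using h1.symm)
    · simpa [Pminus_eq] using h1.neg
    · rintro C (rfl | rfl)
      · exact ⟨hrot.diffeoCircle, hrot.invariant, hrot⟩
      · exact ⟨hrot.neg.diffeoCircle, hrot.neg.invariant, hrot.neg⟩
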